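/- Let $\mathcal O_1,\dots,\mathcal O_d\subset\mathbb T^2=\mathbb R^2/\mathbb Z^2$ be pairwise disjoint closed strictly convex sets (scatterers; each one is the injective image of a compact strictly convex subset of $\mathbb R^2$) whose boundaries are $C^3$ simple closed curves of strictly positive curvature. Let $M=\bigsqcup_{i}\mathbb S_i\times[-\pi/2,\pi/2]$, where $\mathbb S_i$ is the circle of length $|\partial\mathcal O_i|$, be the space of collisions $(r,\varphi)$, where $r$ is the (clockwise) arc length parameter of the position on $\partial\mathcal O_i$ and $\varphi$ is the angle between the post-collision velocity and the outward normal of $\mathcal O_i$. Let $T\colon M\to M$ be the billiard map in the table $Q=\mathbb T^2\setminus\bigcup_i\mathcal O_i$, which sends each collision to the next one (straight motion at unit speed, specular reflection; tangential collisions count as collisions). Assume finite horizon: no trajectory makes only tangential collisions, that is, every complete straight line meets the interior of some scatterer. Let $\mathcal S_0=\{(r,\varphi)\in M:\varphi=\pm\pi/2\}$ and $\mathcal S_n=\bigcup_{k=0}^n T^{-k}\mathcal S_0$ for $n\ge 0$. Let $K_n$ be the maximal number of curves of $\mathcal S_n$ that meet in one point; precisely, $K_n$ is the smallest $k$ such that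 $\mathcal S_n$ is the union of finitely many simple curves (arcs or simple closed curves) of which at most $k$ pass through any one point of $M$. For $0<\varphi_0<\pi/2$ and $n_0\ge1$ let $s_0(\varphi_0,n_0)\in[0,1]$ be the smallest number $s$ such that every orbit segment $x,Tx,\dots,T^{n_0-1}x$ contains at most $s\,n_0$ collisions with $|\varphi|>\varphi_0$. Suppose that there is $K$ such that $K_n\le K$ for all $n\ge0$. Then for every $\varepsilon_0>0$ there exist $n_0\ge1$ and $\varphi_0\in(0,\pi/2)$ such that $s_0(\varphi_0,n_0)<\varepsilon_0$. -/

import Mathlib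

open Set

noncomputable section

/-- The vector `a + b i` of the lattice `ℤ²`, in the plane `ℝ² = ℂ`. -/
def latticeVec (m : ℤ × ℤ) : ℂ := (m.1 : ℂ) + (m.2 : ℂ) * Complex.I

/-- A dispersing billiard table on the torus `𝕋² = ℝ² / ℤ²` (with `ℝ²` written as `ℂ`).
The scatterers are given by lifts `obstacle i` to the plane. They are strictly convex and pairwise
disjoint on the torus, i.e. all their lattice translates are pairwise disjoint. The boundary of
each one is a `C³` simple closed curve, parametrized clockwise by arc length, of strictly
positive curvature. -/
structure DispersingTable where
  /-- number of scatterers -/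
  d : ℕ
  obstacle : Fin d → Set ℂ
  isCompact_obstacle : ∀ i, IsCompact (obstacle i)
  strictConvex_obstacle : ∀ i, StrictConvex ℝ (obstacle i)
  disjoint_obstacle : ∀ (i j : Fin d) (m n : ℤ × ℤ), (i, m) ≠ (j, n) →
    Disjoint ((fun z => z + latticeVec m) '' obstacle i)
      ((fun z => z + latticeVec n) '' obstacle j)
  /-- length of the boundary of the `i`-th scatterer -/
  perimeter : Fin d → ℝ
  perimeter_pos : ∀ i, 0 < perimeter i
  /-- arc length parametrization of the boundary of the `i`-th scatterer -/
  bdry : Fin d → ℝ → ℂ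
  contDiff_bdry : ∀ i, ContDiff ℝ 3 (bdry i)
  periodic_bdry : ∀ i, Function.Periodic (bdry i) (perimeter i)
  injOn_bdry : ∀ i, InjOn (bdry i) (Ico 0 (perimeter i))
  range_bdry : ∀ i, range (bdry i) = frontier (obstacle i)
  norm_deriv_bdry : ∀ i r, ‖deriv (bdry i) r‖ = 1
  /-- The signed curvature `det (c', c'')` is negative: the curve `c` turns to the right, which
  says that the curvature is positive and that the parametrization is clockwise. -/
  curvature_bdry : ∀ i r,
    ((starRingEnd ℂ) (deriv (bdry i) r) * deriv (deriv (bdry i)) r).im < 0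

namespace DispersingTable

variable (B : DispersingTable)

/-- The union of all lattice translates of the scatterers: the lift to the plane of the complement
of the billiard table `Q`. -/
def walls : Set ℂ := ⋃ (i : Fin B.d) (m : ℤ × ℤ), (fun z => z + latticeVec m) '' B.obstacle i

/-- Finite horizon: there is no trajectory making only tangential collisions (or none), i.e. no
complete straight line which avoids the interiors of all scatterers. -/
def FiniteHorizon : Prop :=
  ¬ ∃ p v : ℂ, ‖v‖ = 1 ∧ ∀ (t : ℝ) (i : Fin B.d) (m : ℤ × ℤ),
    p + t * v ∉ interior ((fun z => z + latticeVec m) '' B.obstacle i)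

/-- The phase space `M`, the disjoint union of the cylinders `𝕊ᵢ × [-π/2, π/2]`, where `𝕊ᵢ` is the
circle of length `perimeter i`. Its points are written `⟨i, r, φ⟩`. -/
abbrev Phase : Type :=
  Σ i : Fin B.d, AddCircle (B.perimeter i) × Icc (-(Real.pi / 2)) (Real.pi / 2)

variable {B}

theorem periodic_deriv_bdry (i : Fin B.d) :
    Function.Periodic (deriv (B.bdry i)) (B.perimeter i) := by
  intro r
  have h : (fun s => B.bdry i (s + B.perimeter i)) = B.bdry i := funext (B.periodic_bdry i)
  rw [← deriv_comp_add_const, h]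

namespace Phase

/-- The angle `φ ∈ [-π/2, π/2]` between the outgoing velocity and the outward normal. -/
def angle (x : B.Phase) : ℝ := x.2.2

/-- The position of the collision on the boundary of the (lifted) scatterer. -/
def pos (x : B.Phase) : ℂ := (B.periodic_bdry x.1).lift x.2.1

/-- The unit tangent vector at the point of collision, in the clockwise direction. -/
def tangent (x : B.Phase) : ℂ := (periodic_deriv_bdry x.1).lift x.2.1

/-- The outward unit normal of the scatterer at the point of collision (for a clockwise boundary,
the outside is on the left). -/
def normal (x : B.Phase) : ℂ := Complex.I * x.tangent

/-- The velocity after the collision. -/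
def vel (x : B.Phase) : ℂ := Real.cos x.angle * x.normal + Real.sin x.angle * x.tangent

/-- `y` is the next collision after `x`: the particle leaves `x.pos` with velocity `x.vel`, first
meets a scatterer again, at some time `t > 0`, in the position of `y` (on the torus), and is
reflected there so that the angle of incidence equals the angle of reflection.
Tangential collisions are collisions (and do not change the velocity). -/
def IsNextCollision (x y : B.Phase) : Prop :=
  ∃ (t : ℝ) (m : ℤ × ℤ), 0 < t ∧
    x.pos + t * x.vel = y.pos + latticeVec m ∧
    (∀ s ∈ Ioo 0 t, x.pos + s * x.vel ∉ B.walls) ∧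
    y.vel = x.vel - 2 * (inner ℝ x.vel y.normal : ℝ) * y.normal

end Phase

open Classical in
/-- The billiard map `T : M → M`, which sends a collision to the next one. (For a table with finite
horizon there is always exactly one next collision; the value `x` is never used then.) -/
def billiardMap (x : B.Phase) : B.Phase :=
  if h : ∃ y, x.IsNextCollision y then h.choose else x

variable (B)

/-- The set `S₀` of tangential collisions, `φ = ± π/2`. -/
def tangential : Set B.Phase := {x | |x.angle| = Real.pi / 2}

/-- The singularity set `Sₙ = ⋃_{k = 0}^n T⁻ᵏ S₀`. -/
def singularSet (n : ℕ) : Set B.Phase :=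
  ⋃ k ∈ Finset.range (n + 1), billiardMap^[k] ⁻¹' B.tangential

end DispersingTable

/-- A simple curve in a topological space: an arc (with two distinct end points) or a simple closed
curve. -/
def IsSimpleCurve {X : Type*} [TopologicalSpace X] (γ : Set X) : Prop :=
  (∃ f : C(unitInterval, X), Function.Injective f ∧ range f = γ) ∨
    ∃ f : C(AddCircle (1 : ℝ), X), Function.Injective f ∧ range f = γ

/-- `Γ` is a decomposition of `S` into finitely many simple curves. -/
def IsCurveDecomposition {X : Type*} [TopologicalSpace X] (S : Set X) (Γ : Finset (Set X)) : Prop :=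
  (∀ γ ∈ Γ, IsSimpleCurve γ) ∧ ⋃ γ ∈ Γ, γ = S

namespace DispersingTable

variable (B : DispersingTable)

open Classical in
/-- The complexity `Kₙ`: the maximal number of curves of `Sₙ` which meet in one point. The curves
of `Sₙ` are those of a decomposition of `Sₙ` into finitely many simple curves, and the most
economical decomposition is taken (`⊤` if there were none). -/
def complexity (n : ℕ) : ℕ∞ :=
  ⨅ (Γ : Finset (Set B.Phase)) (_ : IsCurveDecomposition (B.singularSet n) Γ),
    ⨆ x : B.Phase, ((Γ.filter (fun γ => x ∈ γ)).card : ℕ∞)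

open Classical in
/-- `s₀(φ₀, n₀) ≤ 1`: the smallest number `s` such that any orbit segment
`x, T x, …, T^(n₀ - 1) x` of length `n₀` has at most `s n₀` collisions with `|φ| > φ₀`. -/
def sparseness (φ₀ : ℝ) (n₀ : ℕ) : ℝ :=
  sInf {s : ℝ | s ∈ Icc 0 1 ∧ ∀ x : B.Phase,
    (((Finset.range n₀).filter
      (fun k => φ₀ < |Phase.angle (billiardMap^[k] x)|)).card : ℝ) ≤ s * n₀}

end DispersingTable

end

/-!
The theorem holds because an orbit has at most `2 K` tangential collisions if all complexities are
at most `K`. Granted this, orbit segments of a fixed length `n₀` with more than `2 K` almost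
tangential collisions, for `φ₀ → π / 2`, would accumulate at an orbit with more than `2 K`
tangential ones (`exists_card_tangential`); so for `φ₀` close to `π / 2` there are at most
`2 K < ε₀ n₀ / 2` collisions with `|φ| > φ₀` in each segment of length `n₀`.

Let `x` be a point whose orbit has tangential collisions at the indices `j ∈ J`. Going back along
the orbit, `x` may be assumed not to be tangential itself. Each `j ∈ J` contributes a branch of the
singularity set that ends in `x`: the tangential collisions near `Tʲ x`, followed backwards in time
(`frequently_mem_tangentAt`). Branches which belong to different `j` meet in `x` only
(`eventually_not_tangentAt`), and near `x` the singularity set is the union of such branches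
(`exists_eventually_mem_tangentAt`). A simple curve through `x` has two sides at `x`. Each of them
is connected, so it stays in one branch, and `K` curves account for at most `2 K` branches
(`card_le_two_mul_card_filter`).

That different branches meet in `x` only says that a trajectory near that of `x` cannot share two
tangential collisions with it. This is where dispersion enters. For two trajectories with positions
`p, p'` and velocities `v, v'` that are reflected in the same sequence of convex scatterers, the
quantity `⟨v - v', p - p'⟩` increases: by `(t + t') / 2 * ‖v - v'‖²` in a pair of free flights of
durations `t` and `t'`, and by convexity it does not decrease in a reflection (`spread_add_le`). On
the other hand, for two tangential collisions at a scatterer, with boundary curve `γ`, it equals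
`± ⟨γ'(r) - γ'(r'), γ(r) - γ(r')⟩`, which is `o(‖v - v'‖²)` since `γ''` is nonzero and orthogonal
to `γ'` (`eventually_abs_spread_le`). So the velocities agree (`eventually_eq_of_tangential`).

The billiard map is discontinuous, but limits of trajectories are trajectories again, in which
additional tangential collisions may have appeared (`exists_tendsto_iterate`). Ultrafilters on the
phase space keep the itineraries constant in these limits.
-/

/-! ### The boundary of a scatterer -/

namespace DispersingTable

open Filter Topology

variable {B : DispersingTable}

theorem differentiable_bdry (i : Fin B.d) : Differentiable ℝ (B.bdry i) :=
  (B.contDiff_bdry i).differentiable (by norm_num)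

theorem contDiff_deriv_bdry (i : Fin B.d) : ContDiff ℝ 2 (deriv (B.bdry i)) := by
  have h : ContDiff ℝ (2 + 1) (B.bdry i) := by
    have := B.contDiff_bdry i
    norm_num
    exact this
  exact (contDiff_succ_iff_deriv.1 h).2.2

theorem hasDerivAt_bdry (i : Fin B.d) (r : ℝ) :
    HasDerivAt (B.bdry i) (deriv (B.bdry i) r) r :=
  (differentiable_bdry i r).hasDerivAt

theorem hasDerivAt_deriv_bdry (i : Fin B.d) (r : ℝ) :
    HasDerivAt (deriv (B.bdry i)) (deriv (deriv (B.bdry i)) r) r :=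
  ((contDiff_deriv_bdry i).differentiable (by norm_num) r).hasDerivAt

theorem bdry_mem_frontier (i : Fin B.d) (r : ℝ) : B.bdry i r ∈ frontier (B.obstacle i) := by
  rw [← B.range_bdry]
  exact mem_range_self r

theorem bdry_mem_obstacle (i : Fin B.d) (r : ℝ) : B.bdry i r ∈ B.obstacle i :=
  (B.isCompact_obstacle i).isClosed.frontier_subset (bdry_mem_frontier i r)

theorem convex_obstacle (i : Fin B.d) : Convex ℝ (B.obstacle i) :=
  (B.strictConvex_obstacle i).convex

theorem nonempty_interior_obstacle (i : Fin B.d) : (interior (B.obstacle i)).Nonempty := by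
  have hp := B.perimeter_pos i
  have hne : B.bdry i 0 ≠ B.bdry i (B.perimeter i / 2) := by
    intro h
    have := B.injOn_bdry i (⟨le_refl _, hp⟩ : (0 : ℝ) ∈ Ico 0 (B.perimeter i))
      ⟨by linarith, by linarith⟩ h
    linarith
  have hsub := (B.strictConvex_obstacle i).openSegment_subset (bdry_mem_obstacle i 0)
    (bdry_mem_obstacle i (B.perimeter i / 2)) hne
  exact ⟨_, hsub (midpoint_mem_openSegment _ _)⟩

theorem closure_interior_obstacle (i : Fin B.d) :
    closure (interior (B.obstacle i)) = B.obstacle i := by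
  rw [(convex_obstacle i).closure_interior_eq_closure_of_nonempty_interior
    (nonempty_interior_obstacle i), (B.isCompact_obstacle i).isClosed.closure_eq]

theorem eq_inner_smul_add {τ : ℂ} (hτ : ‖τ‖ = 1) (w : ℂ) :
    w = (inner ℝ (Complex.I * τ) w : ℝ) * (Complex.I * τ) + (inner ℝ τ w : ℝ) * τ := by
  have h1 : τ.re * τ.re + τ.im * τ.im = 1 := by
    have := Complex.normSq_eq_norm_sq τ
    rw [hτ, Complex.normSq_apply] at this
    linarith
  apply Complex.ext <;>
    simp only [Complex.inner, Complex.add_re, Complex.mul_re, Complex.mul_im, Complex.I_re,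
      Complex.I_im, Complex.conj_re, Complex.conj_im, Complex.ofReal_re, Complex.ofReal_im,
      Complex.add_im]
  · linear_combination (-w.re) * h1
  · linear_combination (-w.im) * h1

/-- A supporting functional of a scatterer at a boundary point is a positive multiple of
`I * tangent`. The sign of the curvature enters here: it decides on which side of the (clockwise)
boundary curve the scatterer lies. -/
theorem exists_pos_eq_of_supports {i : Fin B.d} {r : ℝ} {u : ℂ} (hu : u ≠ 0)
    (h : ∀ c ∈ B.obstacle i, inner ℝ u c ≤ inner ℝ u (B.bdry i r)) :
    ∃ a : ℝ, 0 < a ∧ u = a * (Complex.I * deriv (B.bdry i) r) := by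
  set γ := B.bdry i with hγ
  set g : ℝ → ℝ := fun s => inner ℝ u (γ s) with hg
  have hg1 : ∀ s, HasDerivAt g (inner ℝ u (deriv γ s)) s := fun s => by
    have := (hasDerivAt_const s u).inner ℝ (hasDerivAt_bdry i s)
    rwa [inner_zero_left, add_zero] at this
  have hg2 : ∀ s, HasDerivAt (fun s => (inner ℝ u (deriv γ s) : ℝ))
      (inner ℝ u (deriv (deriv γ) s)) s := fun s => by
    have := (hasDerivAt_const s u).inner ℝ (hasDerivAt_deriv_bdry i s)
    rwa [inner_zero_left, add_zero] at this
  have hdg : deriv g = fun s => (inner ℝ u (deriv γ s) : ℝ) := funext fun s => (hg1 s).deriv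
  have hmax : ∀ s, g s ≤ g r := fun s => h _ (bdry_mem_obstacle i s)
  have h0 : inner ℝ u (deriv γ r) = 0 := by
    have : IsLocalMax g r := Eventually.of_forall hmax
    exact this.hasDerivAt_eq_zero (hg1 r)
  set a : ℝ := inner ℝ (Complex.I * deriv γ r) u with ha
  have hua : u = a * (Complex.I * deriv γ r) := by
    have := eq_inner_smul_add (B.norm_deriv_bdry i r) u
    rw [← hγ, real_inner_comm u (deriv γ r), h0] at this
    rwa [Complex.ofReal_zero, zero_mul, add_zero] at this
  refine ⟨a, ?_, hua⟩
  by_contra hneg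
  have ha0 : a ≠ 0 := by
    rintro h
    rw [h] at hua
    exact hu (by simpa using hua)
  have hlt : a < 0 := lt_of_le_of_ne (not_lt.1 hneg) ha0
  have hpos : 0 < deriv (deriv g) r := by
    rw [hdg, (hg2 r).deriv]
    have hk := B.curvature_bdry i r
    rw [← hγ] at hk
    have : (inner ℝ u (deriv (deriv γ) r) : ℝ)
        = a * ((starRingEnd ℂ) (deriv γ r) * deriv (deriv γ) r).im := by
      rw [hua, Complex.inner]
      simp only [map_mul, Complex.conj_ofReal, Complex.conj_I, Complex.mul_re, Complex.mul_im,
        Complex.ofReal_re, Complex.ofReal_im, Complex.neg_re, Complex.neg_im, Complex.I_re,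
        Complex.I_im, Complex.conj_re, Complex.conj_im]
      ring
    rw [this]
    exact mul_pos_of_neg_of_neg hlt hk
  have hmin := isLocalMin_of_deriv_deriv_pos hpos (by rw [hdg]; exact h0) (hg1 r).continuousAt
  have hconst : g =ᶠ[𝓝 r] fun _ => g r := by
    filter_upwards [hmin] with s hs
    exact le_antisymm (hmax s) hs
  have := hconst.deriv.deriv_eq
  simp at this
  exact hpos.ne' this

/-- Separation of a scatterer from a convex set that touches it from outside. -/
theorem inner_normal_separates {i : Fin B.d} {r : ℝ} {t : Set ℂ} (ht : Convex ℝ t)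
    (hdisj : Disjoint (interior (B.obstacle i)) t) (hr : B.bdry i r ∈ t) :
    (∀ c ∈ B.obstacle i,
      inner ℝ (Complex.I * deriv (B.bdry i) r) (c - B.bdry i r) ≤ 0) ∧
    ∀ b ∈ t, 0 ≤ inner ℝ (Complex.I * deriv (B.bdry i) r) (b - B.bdry i r) := by
  obtain ⟨f, a, hfa, hfb⟩ := geometric_hahn_banach_open (convex_obstacle i).interior
    isOpen_interior ht hdisj
  set u := (InnerProductSpace.toDual ℝ ℂ).symm f with hu
  have hfu : ∀ z, f z = inner ℝ u z := fun z => by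
    rw [hu, InnerProductSpace.toDual_symm_apply]
  have hle : ∀ c ∈ B.obstacle i, f c ≤ a := by
    intro c hc
    rw [← closure_interior_obstacle] at hc
    exact closure_minimal (fun z hz => (hfa z hz).le)
      (isClosed_le f.continuous continuous_const) hc
  have hra : f (B.bdry i r) = a := le_antisymm (hle _ (bdry_mem_obstacle i r)) (hfb _ hr)
  have hu0 : u ≠ 0 := by
    intro h0
    obtain ⟨z, hz⟩ := nonempty_interior_obstacle i
    have h1 := hfa z hz
    rw [← hra, hfu, hfu, h0] at h1
    simp at h1
  obtain ⟨c, hc, huc⟩ := exists_pos_eq_of_supports (i := i) (r := r) hu0 (fun z hz => by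
    rw [← hfu, ← hfu, hra]; exact hle z hz)
  have key : ∀ z, f z - a = c * inner ℝ (Complex.I * deriv (B.bdry i) r) (z - B.bdry i r) := by
    intro z
    rw [← hra, ← map_sub, hfu]
    nth_rw 1 [huc]
    rw [← Complex.real_smul, real_inner_smul_left]
  constructor
  · intro z hz
    have := hle z hz
    have h2 := key z
    by_contra! h3
    nlinarith
  · intro z hz
    have := hfb z hz
    have h2 := key z
    by_contra! h3
    nlinarith

theorem inner_normal_nonpos {i : Fin B.d} (r : ℝ) {c : ℂ} (hc : c ∈ B.obstacle i) :
    inner ℝ (Complex.I * deriv (B.bdry i) r) (c - B.bdry i r) ≤ 0 :=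
  (inner_normal_separates (convex_singleton (B.bdry i r))
    (disjoint_singleton_right.2 (bdry_mem_frontier i r).2) rfl).1 c hc

theorem inner_normal_neg_of_mem_interior {i : Fin B.d} (r : ℝ) {c : ℂ}
    (hc : c ∈ interior (B.obstacle i)) :
    inner ℝ (Complex.I * deriv (B.bdry i) r) (c - B.bdry i r) < 0 := by
  set n := Complex.I * deriv (B.bdry i) r with hn
  have hn1 : (inner ℝ n n : ℝ) = 1 := by
    rw [real_inner_self_eq_norm_sq, hn, norm_mul, B.norm_deriv_bdry]
    simp
  have hlim : Tendsto (fun s : ℝ => c + s * n) (𝓝[>] 0) (𝓝 c) := by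
    have : Continuous (fun s : ℝ => c + s * n) := by fun_prop
    have h2 := this.tendsto 0
    simp only [Complex.ofReal_zero, zero_mul, add_zero] at h2
    exact h2.mono_left nhdsWithin_le_nhds
  obtain ⟨s, hs, hs0⟩ := ((hlim.eventually (mem_interior_iff_mem_nhds.1 hc)).and
    self_mem_nhdsWithin).exists
  have h1 := inner_normal_nonpos r hs
  rw [← hn, show c + s * n - B.bdry i r = (c - B.bdry i r) + (s : ℝ) • n by
    rw [Complex.real_smul]; ring, inner_add_right, real_inner_smul_right, hn1] at h1
  have : (0 : ℝ) < s := hs0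
  linarith

theorem inner_normal_neg {i : Fin B.d} (r : ℝ) {c : ℂ} (hc : c ∈ B.obstacle i)
    (hne : c ≠ B.bdry i r) :
    inner ℝ (Complex.I * deriv (B.bdry i) r) (c - B.bdry i r) < 0 := by
  have h := (B.strictConvex_obstacle i).openSegment_subset hc (bdry_mem_obstacle i r) hne
    (midpoint_mem_openSegment _ _)
  have h1 := inner_normal_neg_of_mem_interior r h
  have h2 : midpoint ℝ c (B.bdry i r) - B.bdry i r = (2⁻¹ : ℝ) • (c - B.bdry i r) := by
    rw [midpoint_sub_right]
    simp
  rw [h2, real_inner_smul_right] at h1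
  linarith

/-- A line that crosses the tangent line inwards enters the interior of the scatterer. -/
theorem exists_mem_interior_of_inner_neg {i : Fin B.d} {r : ℝ} {v : ℂ}
    (hv : inner ℝ (Complex.I * deriv (B.bdry i) r) v < 0) {δ : ℝ} (hδ : 0 < δ) :
    ∃ s ∈ Ioo 0 δ, B.bdry i r + s * v ∈ interior (B.obstacle i) := by
  have h1 : ∃ s : ℝ, 0 < s ∧ B.bdry i r + s * v ∈ interior (B.obstacle i) := by
    by_contra! hcon
    set t : Set ℂ := (fun s : ℝ => B.bdry i r + s * v) '' Ici 0 with ht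
    have hconv : Convex ℝ t := by
      rintro _ ⟨s, hs, rfl⟩ _ ⟨s', hs', rfl⟩ a b ha hb hab
      refine ⟨a * s + b * s', add_nonneg (mul_nonneg ha hs) (mul_nonneg hb hs'), ?_⟩
      have hab' : (a : ℂ) + b = 1 := by exact_mod_cast hab
      simp only [Complex.real_smul]
      push_cast
      linear_combination (-(B.bdry i r)) * hab'
    have hdisj : Disjoint (interior (B.obstacle i)) t := by
      rw [Set.disjoint_right]
      rintro _ ⟨s, hs, rfl⟩
      rcases eq_or_lt_of_le (show (0 : ℝ) ≤ s from hs) with rfl | h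
      · simpa using (bdry_mem_frontier i r).2
      · exact hcon s h
    have := (inner_normal_separates hconv hdisj (r := r)
      ⟨0, self_mem_Ici, by simp⟩).2 _
      ⟨1, zero_le_one' ℝ, rfl⟩
    simp only [Complex.ofReal_one, one_mul, add_sub_cancel_left] at this
    linarith
  obtain ⟨s, hs, hmem⟩ := h1
  -- the open segment between a boundary point and an interior point lies in the interior
  have hseg := (convex_obstacle i).openSegment_interior_self_subset_interior hmem
    (bdry_mem_obstacle i r)
  set ρ := min (1 / 2) (δ / (2 * s)) with hρ
  have hρ0 : 0 < ρ := lt_min (by norm_num) (by positivity)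
  have hρ1 : ρ ≤ 1 / 2 := min_le_left _ _
  have hρ2 : ρ * s < δ := by
    have : ρ ≤ δ / (2 * s) := min_le_right _ _
    calc ρ * s ≤ δ / (2 * s) * s := by gcongr
      _ = δ / 2 := by field_simp
      _ < δ := by linarith
  refine ⟨ρ * s, ⟨by positivity, hρ2⟩, hseg ⟨ρ, 1 - ρ, hρ0, by linarith, by ring, ?_⟩⟩
  simp only [Complex.real_smul]
  push_cast
  ring

end DispersingTable

/-! ### The lattice and the walls -/

theorem latticeVec_add (m n : ℤ × ℤ) : latticeVec (m + n) = latticeVec m + latticeVec n := by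
  simp only [latticeVec, Prod.fst_add, Prod.snd_add]
  push_cast
  ring

theorem latticeVec_sub (m n : ℤ × ℤ) : latticeVec (m - n) = latticeVec m - latticeVec n := by
  rw [eq_sub_iff_add_eq, ← latticeVec_add, sub_add_cancel]

@[simp] theorem latticeVec_zero : latticeVec 0 = 0 := by simp [latticeVec]

theorem latticeVec_neg (m : ℤ × ℤ) : latticeVec (-m) = -latticeVec m := by
  rw [← zero_sub, latticeVec_sub, latticeVec_zero, zero_sub]

@[simp] theorem latticeVec_re (m : ℤ × ℤ) : (latticeVec m).re = m.1 := by simp [latticeVec]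

@[simp] theorem latticeVec_im (m : ℤ × ℤ) : (latticeVec m).im = m.2 := by simp [latticeVec]

theorem one_le_norm_latticeVec {m : ℤ × ℤ} (hm : m ≠ 0) : 1 ≤ ‖latticeVec m‖ := by
  by_cases h : m.1 = 0
  · have h2 : m.2 ≠ 0 := fun h2 => hm (Prod.ext h h2)
    have := Complex.abs_im_le_norm (latticeVec m)
    rw [latticeVec_im] at this
    have h3 : (1 : ℝ) ≤ |(m.2 : ℝ)| := by exact_mod_cast Int.one_le_abs h2
    linarith
  · have := Complex.abs_re_le_norm (latticeVec m)
    rw [latticeVec_re] at this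
    have h3 : (1 : ℝ) ≤ |(m.1 : ℝ)| := by exact_mod_cast Int.one_le_abs h
    linarith

theorem isClosed_image_latticeVec (s : Set (ℤ × ℤ)) : IsClosed (latticeVec '' s) := by
  refine Metric.isClosed_of_pairwise_le_dist one_pos ?_
  rintro _ ⟨m, -, rfl⟩ _ ⟨n, -, rfl⟩ hne
  rw [dist_eq_norm, ← latticeVec_sub]
  refine one_le_norm_latticeVec fun h => hne ?_
  rw [sub_eq_zero.1 h]

namespace DispersingTable

open Filter Topology Pointwise

variable {B : DispersingTable}

theorem mem_walls_iff {z : ℂ} : z ∈ B.walls ↔ ∃ i m, z - latticeVec m ∈ B.obstacle i := by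
  simp only [walls, mem_iUnion, mem_image]
  constructor
  · rintro ⟨i, m, w, hw, rfl⟩
    exact ⟨i, m, by simpa using hw⟩
  · rintro ⟨i, m, h⟩
    exact ⟨i, m, _, h, by simp⟩

theorem eq_of_mem_obstacle {z : ℂ} {i j : Fin B.d} {m n : ℤ × ℤ}
    (hi : z - latticeVec m ∈ B.obstacle i) (hj : z - latticeVec n ∈ B.obstacle j) :
    i = j ∧ m = n := by
  by_contra hne
  have h : (i, m) ≠ (j, n) := fun h => hne (by simpa using h)
  exact Set.disjoint_left.1 (B.disjoint_obstacle i j m n h)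
    (show z ∈ _ from ⟨z - latticeVec m, hi, by simp⟩) ⟨z - latticeVec n, hj, by simp⟩

variable (B) in
/-- The union of the interiors of all lattice translates of the scatterers. -/
def openWalls : Set ℂ := {z | ∃ i m, z - latticeVec m ∈ interior (B.obstacle i)}

theorem isOpen_openWalls : IsOpen B.openWalls := by
  have : B.openWalls = ⋃ (i : Fin B.d) (m : ℤ × ℤ),
      (fun z => z - latticeVec m) ⁻¹' interior (B.obstacle i) := by
    ext z
    simp [openWalls]
  rw [this]
  exact isOpen_iUnion fun i => isOpen_iUnion fun m =>
    isOpen_interior.preimage (by fun_prop)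

theorem openWalls_subset_walls : B.openWalls ⊆ B.walls := fun _ ⟨i, m, h⟩ =>
  mem_walls_iff.2 ⟨i, m, interior_subset h⟩

theorem add_latticeVec_mem_openWalls {z : ℂ} (m : ℤ × ℤ) :
    z + latticeVec m ∈ B.openWalls ↔ z ∈ B.openWalls := by
  constructor
  · rintro ⟨i, n, h⟩
    refine ⟨i, n - m, ?_⟩
    rwa [latticeVec_sub, sub_sub_eq_add_sub]
  · rintro ⟨i, n, h⟩
    refine ⟨i, n + m, ?_⟩
    rwa [latticeVec_add, add_sub_add_right_eq_sub]

theorem add_latticeVec_mem_walls {z : ℂ} (m : ℤ × ℤ) :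
    z + latticeVec m ∈ B.walls ↔ z ∈ B.walls := by
  simp only [mem_walls_iff]
  constructor
  · rintro ⟨i, n, h⟩
    refine ⟨i, n - m, ?_⟩
    rwa [latticeVec_sub, sub_sub_eq_add_sub]
  · rintro ⟨i, n, h⟩
    refine ⟨i, n + m, ?_⟩
    rwa [latticeVec_add, add_sub_add_right_eq_sub]

theorem mem_interior_image_iff {z c : ℂ} {s : Set ℂ} :
    z ∈ interior ((fun w => w + c) '' s) ↔ z - c ∈ interior s := by
  have h := (Homeomorph.addRight c).image_interior s
  simp only [Homeomorph.coe_addRight] at h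
  rw [← h]
  constructor
  · rintro ⟨w, hw, rfl⟩
    simpa using hw
  · intro hz
    exact ⟨_, hz, by simp⟩

theorem isClosed_iUnion_translates (s : Set (Fin B.d × (ℤ × ℤ))) :
    IsClosed {z | ∃ i m, (i, m) ∈ s ∧ z - latticeVec m ∈ B.obstacle i} := by
  have : {z | ∃ i m, (i, m) ∈ s ∧ z - latticeVec m ∈ B.obstacle i} =
      ⋃ i : Fin B.d, (latticeVec '' {m | (i, m) ∈ s}) + B.obstacle i := by
    ext z
    simp only [mem_ofPred_eq, mem_iUnion, Set.mem_add, mem_image]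
    constructor
    · rintro ⟨i, m, hs, hz⟩
      exact ⟨i, _, ⟨m, hs, rfl⟩, _, hz, by ring⟩
    · rintro ⟨i, _, ⟨m, hs, rfl⟩, w, hw, rfl⟩
      exact ⟨i, m, hs, by simpa using hw⟩
  rw [this]
  exact isClosed_iUnion_of_finite fun i =>
    (isClosed_image_latticeVec _).add_right_of_isCompact (B.isCompact_obstacle i)

theorem isClosed_walls : IsClosed B.walls := by
  convert isClosed_iUnion_translates (B := B) univ using 1
  ext z
  simp [mem_walls_iff]

variable (B) in
theorem exists_separation : ∃ δ : ℝ, 0 < δ ∧ ∀ (i j : Fin B.d) (m n : ℤ × ℤ) (z w : ℂ),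
    (i, m) ≠ (j, n) → z - latticeVec m ∈ B.obstacle i → w - latticeVec n ∈ B.obstacle j →
    δ ≤ dist z w := by
  have h : ∀ i : Fin B.d, ∃ δ : ℝ, 0 < δ ∧ ∀ (j : Fin B.d) (n : ℤ × ℤ) (z w : ℂ),
      (i, 0) ≠ (j, n) → z ∈ B.obstacle i → w - latticeVec n ∈ B.obstacle j → δ ≤ dist z w := by
    intro i
    have hdis : Disjoint (B.obstacle i)
        {z | ∃ j n, (j, n) ∈ {p | (i, (0 : ℤ × ℤ)) ≠ p} ∧ z - latticeVec n ∈ B.obstacle j} := by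
      rw [Set.disjoint_left]
      rintro z hz ⟨j, n, hne, hj⟩
      obtain ⟨rfl, h⟩ := eq_of_mem_obstacle (m := 0) (by simpa using hz) hj
      exact hne (by rw [← h])
    obtain ⟨δ, hδ, hd⟩ := hdis.exists_thickenings (B.isCompact_obstacle i)
      (isClosed_iUnion_translates _)
    refine ⟨δ, hδ, fun j n z w hne hz hw => ?_⟩
    by_contra! hlt
    refine Set.disjoint_left.1 hd (Metric.mem_thickening_iff.2 ⟨z, hz, ?_⟩)
      (Metric.self_subset_thickening hδ _ ⟨j, n, hne, hw⟩)
    rwa [dist_comm]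
  choose δ hδ hd using h
  obtain ⟨ε, hε, hε0⟩ := ((eventually_all.2 fun i => Ioo_mem_nhdsGT (hδ i)).and
    (self_mem_nhdsWithin : Ioi (0 : ℝ) ∈ 𝓝[>] 0)).exists
  refine ⟨ε, hε0, fun i j m n z w hne hz hw => ?_⟩
  have := hd i j (n - m) (z - latticeVec m) (w - latticeVec m) ?_ hz ?_
  · rw [dist_sub_right] at this
    exact (hε i).2.le.trans this
  · intro heq
    apply hne
    simp only [Prod.mk.injEq] at heq ⊢
    exact ⟨heq.1, (sub_eq_zero.1 heq.2.symm).symm⟩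
  · rw [latticeVec_sub]
    convert hw using 1
    ring

variable (B) in
/-- A positive lower bound for the distance of two different lifted scatterers. -/
noncomputable def gap : ℝ := B.exists_separation.choose

theorem gap_pos : 0 < B.gap := B.exists_separation.choose_spec.1

theorem gap_le_dist {i j : Fin B.d} {m n : ℤ × ℤ} {z w : ℂ} (hne : (i, m) ≠ (j, n))
    (hz : z - latticeVec m ∈ B.obstacle i) (hw : w - latticeVec n ∈ B.obstacle j) :
    B.gap ≤ dist z w :=
  B.exists_separation.choose_spec.2 i j m n z w hne hz hw

theorem notMem_interior_of_frontier {i : Fin B.d} {z : ℂ} {m : ℤ × ℤ}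
    (hz : z - latticeVec m ∈ frontier (B.obstacle i)) : z ∉ B.openWalls := by
  rintro ⟨j, n, h⟩
  obtain ⟨rfl, rfl⟩ := eq_of_mem_obstacle (interior_subset h)
    ((B.isCompact_obstacle i).isClosed.frontier_subset hz)
  exact hz.2 h

/-! ### The phase space -/

namespace Phase

theorem exists_rep (x : B.Phase) : ∃ r : ℝ, x.2.1 = (r : AddCircle (B.perimeter x.1)) := by
  obtain ⟨r, hr⟩ := QuotientAddGroup.mk_surjective x.2.1
  exact ⟨r, hr.symm⟩

theorem pos_eq {x : B.Phase} {r : ℝ} (h : x.2.1 = (r : AddCircle (B.perimeter x.1))) :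
    x.pos = B.bdry x.1 r := by
  rw [pos, h]
  rfl

theorem tangent_eq {x : B.Phase} {r : ℝ} (h : x.2.1 = (r : AddCircle (B.perimeter x.1))) :
    x.tangent = deriv (B.bdry x.1) r := by
  rw [tangent, h]
  rfl

theorem norm_tangent (x : B.Phase) : ‖x.tangent‖ = 1 := by
  obtain ⟨r, hr⟩ := x.exists_rep
  rw [tangent_eq hr, B.norm_deriv_bdry]

theorem norm_normal (x : B.Phase) : ‖x.normal‖ = 1 := by
  rw [normal, norm_mul, norm_tangent]
  simp

theorem inner_tangent_normal (x : B.Phase) : inner ℝ x.tangent x.normal = 0 := by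
  rw [normal, Complex.inner]
  simp only [Complex.mul_re, Complex.mul_im, Complex.I_re, Complex.I_im, Complex.conj_re,
    Complex.conj_im]
  ring

theorem vel_eq (x : B.Phase) :
    x.vel = Real.cos x.angle • x.normal + Real.sin x.angle • x.tangent := by
  rw [vel, Complex.real_smul, Complex.real_smul]

theorem inner_normal_vel (x : B.Phase) : inner ℝ x.normal x.vel = Real.cos x.angle := by
  rw [vel_eq, inner_add_right, real_inner_smul_right, real_inner_smul_right,
    real_inner_self_eq_norm_sq, norm_normal, real_inner_comm, inner_tangent_normal]
  ring

theorem inner_tangent_vel (x : B.Phase) : inner ℝ x.tangent x.vel = Real.sin x.angle := by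
  rw [vel_eq, inner_add_right, real_inner_smul_right, real_inner_smul_right,
    inner_tangent_normal, real_inner_self_eq_norm_sq, norm_tangent]
  ring

theorem norm_vel (x : B.Phase) : ‖x.vel‖ = 1 := by
  have h : inner ℝ x.vel x.vel = (1 : ℝ) := by
    nth_rw 1 [vel_eq]
    rw [inner_add_left, real_inner_smul_left, real_inner_smul_left, inner_normal_vel,
      inner_tangent_vel]
    nlinarith [Real.sin_sq_add_cos_sq x.angle]
  rw [real_inner_self_eq_norm_sq] at h
  nlinarith [norm_nonneg x.vel]

theorem abs_angle_le (x : B.Phase) : |x.angle| ≤ Real.pi / 2 :=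
  abs_le.2 x.2.2.2

theorem cos_angle_nonneg (x : B.Phase) : 0 ≤ Real.cos x.angle :=
  Real.cos_nonneg_of_mem_Icc x.2.2.2

theorem mem_tangential_iff {x : B.Phase} : x ∈ B.tangential ↔ Real.cos x.angle = 0 := by
  have hx := x.2.2.2
  constructor
  · intro h
    have h' : |x.angle| = Real.pi / 2 := h
    rw [← Real.cos_abs, h', Real.cos_pi_div_two]
  · intro h
    by_contra hne
    have hlt : |x.angle| < Real.pi / 2 := lt_of_le_of_ne x.abs_angle_le hne
    exact (Real.cos_pos_of_mem_Ioo (abs_lt.1 hlt)).ne' h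

theorem pos_mem_frontier (x : B.Phase) : x.pos ∈ frontier (B.obstacle x.1) := by
  obtain ⟨r, hr⟩ := x.exists_rep
  rw [pos_eq hr]
  exact bdry_mem_frontier _ _

theorem pos_mem_obstacle (x : B.Phase) : x.pos ∈ B.obstacle x.1 :=
  (B.isCompact_obstacle x.1).isClosed.frontier_subset x.pos_mem_frontier

theorem inner_normal_sub_pos_nonpos (x : B.Phase) {c : ℂ} (hc : c ∈ B.obstacle x.1) :
    inner ℝ x.normal (c - x.pos) ≤ 0 := by
  obtain ⟨r, hr⟩ := x.exists_rep
  rw [pos_eq hr, normal, tangent_eq hr]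
  exact inner_normal_nonpos r hc

theorem inner_normal_sub_pos_neg (x : B.Phase) {c : ℂ} (hc : c ∈ B.obstacle x.1)
    (hne : c ≠ x.pos) : inner ℝ x.normal (c - x.pos) < 0 := by
  obtain ⟨r, hr⟩ := x.exists_rep
  rw [pos_eq hr] at hne ⊢
  rw [normal, tangent_eq hr]
  exact inner_normal_neg r hc hne

theorem exists_mem_interior (x : B.Phase) {v : ℂ} (hv : inner ℝ x.normal v < 0) {δ : ℝ}
    (hδ : 0 < δ) : ∃ s ∈ Ioo 0 δ, x.pos + s * v ∈ interior (B.obstacle x.1) := by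
  obtain ⟨r, hr⟩ := x.exists_rep
  rw [normal, tangent_eq hr] at hv
  rw [pos_eq hr]
  exact exists_mem_interior_of_inner_neg hv hδ

instance (i : Fin B.d) : Fact (0 < B.perimeter i) := ⟨B.perimeter_pos i⟩

/-- Two collisions in the same place differ in the angle only. -/
theorem eq_mk_of_pos_eq {x y : B.Phase} {m n : ℤ × ℤ}
    (hpos : x.pos + latticeVec m = y.pos + latticeVec n) :
    m = n ∧ ∃ i a φ ψ, x = ⟨i, a, φ⟩ ∧ y = ⟨i, a, ψ⟩ := by
  have hmem : (x.pos + latticeVec m) - latticeVec n ∈ B.obstacle y.1 := by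
    rw [hpos, add_sub_cancel_right]
    exact y.pos_mem_obstacle
  obtain ⟨h1, rfl⟩ := eq_of_mem_obstacle (z := x.pos + latticeVec m) (m := m) (i := x.1)
    (by simpa using x.pos_mem_obstacle) hmem
  refine ⟨rfl, ?_⟩
  have hpos' : x.pos = y.pos := add_right_cancel hpos
  obtain ⟨i, a, φ⟩ := x
  obtain ⟨j, b, ψ⟩ := y
  obtain rfl : i = j := h1
  have hab : a = b := by
    set a' := (AddCircle.equivIco (B.perimeter i) 0 a) with ha'
    set b' := (AddCircle.equivIco (B.perimeter i) 0 b) with hb'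
    have ha : a = ((a' : ℝ) : AddCircle (B.perimeter i)) := (AddCircle.coe_equivIco).symm
    have hb : b = ((b' : ℝ) : AddCircle (B.perimeter i)) := (AddCircle.coe_equivIco).symm
    have h1 : Phase.pos (B := B) ⟨i, a, φ⟩ = B.bdry i a' := pos_eq (x := ⟨i, a, φ⟩) ha
    have h2 : Phase.pos (B := B) ⟨i, b, ψ⟩ = B.bdry i b' := pos_eq (x := ⟨i, b, ψ⟩) hb
    rw [h1, h2] at hpos'
    have hA : (a' : ℝ) ∈ Ico 0 (B.perimeter i) := ⟨a'.2.1, by simpa using a'.2.2⟩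
    have hB : (b' : ℝ) ∈ Ico 0 (B.perimeter i) := ⟨b'.2.1, by simpa using b'.2.2⟩
    have := B.injOn_bdry i hA hB hpos'
    rw [ha, hb, this]
  subst hab
  exact ⟨i, a, φ, ψ, rfl, rfl⟩

theorem normal_eq_of_pos_eq {x y : B.Phase} {m n : ℤ × ℤ}
    (hpos : x.pos + latticeVec m = y.pos + latticeVec n) : x.normal = y.normal := by
  obtain ⟨-, i, a, φ, ψ, rfl, rfl⟩ := eq_mk_of_pos_eq hpos
  rfl

/-- A phase point is determined by the position and the velocity. -/
theorem ext_of_pos_vel {x y : B.Phase} {m n : ℤ × ℤ}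
    (hpos : x.pos + latticeVec m = y.pos + latticeVec n) (hvel : x.vel = y.vel) : x = y := by
  obtain ⟨-, i, a, φ, ψ, rfl, rfl⟩ := eq_mk_of_pos_eq hpos
  have hs : Real.sin φ = Real.sin ψ := by
    have h1 := inner_tangent_vel (B := B) ⟨i, a, φ⟩
    have h2 := inner_tangent_vel (B := B) ⟨i, a, ψ⟩
    rw [← hvel] at h2
    exact h1.symm.trans h2
  have hφ : φ = ψ := Subtype.ext (Real.injOn_sin φ.2 ψ.2 hs)
  rw [hφ]

theorem continuous_pos : Continuous (pos : B.Phase → ℂ) := by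
  refine continuous_sigma fun i => ?_
  have : Continuous (B.periodic_bdry i).lift :=
    continuous_coinduced_dom.2 (differentiable_bdry i).continuous
  exact this.comp continuous_fst

theorem continuous_tangent : Continuous (tangent : B.Phase → ℂ) := by
  refine continuous_sigma fun i => ?_
  have : Continuous (periodic_deriv_bdry i).lift :=
    continuous_coinduced_dom.2 (contDiff_deriv_bdry i).continuous
  exact this.comp continuous_fst

theorem continuous_normal : Continuous (normal : B.Phase → ℂ) :=
  continuous_const.mul continuous_tangent

theorem continuous_angle : Continuous (angle : B.Phase → ℝ) :=
  continuous_sigma fun _ => continuous_subtype_val.comp continuous_snd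

theorem continuous_vel : Continuous (vel : B.Phase → ℂ) := by
  have h1 := continuous_angle (B := B)
  have h2 := continuous_tangent (B := B)
  have h3 := continuous_normal (B := B)
  unfold vel
  fun_prop

theorem isClosed_tangential : IsClosed B.tangential :=
  isClosed_eq continuous_angle.abs continuous_const

end Phase

end DispersingTable

namespace DispersingTable

open Filter Topology

variable {B : DispersingTable}

/-! ### Consequences of finite horizon -/

/-- By compactness, finite horizon is uniform: all segments of some fixed length meet the interior
of a scatterer. -/
theorem FiniteHorizon.exists_length (hB : B.FiniteHorizon) :
    ∃ L : ℝ, ∀ p v : ℂ, ‖v‖ = 1 → ∃ t ∈ Ioo 0 L, p + t * v ∈ B.openWalls := by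
  by_contra! hcon
  choose p v hv hpv using fun n : ℕ => hcon (2 * (n + 1))
  -- recentre the segments at their midpoints and move the midpoints to the unit square
  set m : ℕ → ℤ × ℤ := fun n =>
    (⌊(p n + (n + 1) * v n).re⌋, ⌊(p n + (n + 1) * v n).im⌋) with hm
  set q : ℕ → ℂ := fun n => p n + (n + 1) * v n - latticeVec (m n) with hq
  have hq1 : ∀ n, q n ∈ Metric.closedBall (0 : ℂ) 2 := by
    intro n
    rw [mem_closedBall_zero_iff]
    refine (Complex.norm_le_abs_re_add_abs_im _).trans ?_
    have h1 : (q n).re = Int.fract (p n + (n + 1) * v n).re := by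
      rw [hq, Complex.sub_re, latticeVec_re]
      rfl
    have h2 : (q n).im = Int.fract (p n + (n + 1) * v n).im := by
      rw [hq, Complex.sub_im, latticeVec_im]
      rfl
    rw [h1, h2, abs_of_nonneg (Int.fract_nonneg _), abs_of_nonneg (Int.fract_nonneg _)]
    linarith [(Int.fract_lt_one (p n + (n + 1) * v n).re).le,
      (Int.fract_lt_one (p n + (n + 1) * v n).im).le]
  obtain ⟨⟨q₀, v₀⟩, ⟨-, hv₀⟩, φ, hφ, hlim⟩ :=
    ((isCompact_closedBall (0 : ℂ) 2).prod (isCompact_sphere (0 : ℂ) 1)).tendsto_subseq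
      (x := fun n => (q n, v n)) fun n => ⟨hq1 n, by simp [hv n]⟩
  have hv₀1 : ‖v₀‖ = 1 := by simpa using hv₀
  apply hB
  refine ⟨q₀, v₀, hv₀1, fun t i k hmem => ?_⟩
  rw [mem_interior_image_iff] at hmem
  have hopen : q₀ + t * v₀ ∈ B.openWalls := ⟨i, k, hmem⟩
  have hcont : Tendsto (fun n => q (φ n) + t * v (φ n)) atTop (𝓝 (q₀ + t * v₀)) := by
    have h1 := (continuous_fst.tendsto _).comp hlim
    have h2 := (continuous_snd.tendsto _).comp hlim
    exact h1.add (h2.const_mul _)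
  obtain ⟨n, hn, hnt⟩ := ((hcont.eventually (isOpen_openWalls.mem_nhds hopen)).and
    ((hφ.tendsto_atTop).eventually (eventually_ge_atTop ⌈|t|⌉₊))).exists
  have hnt' : |t| ≤ φ n := (Nat.le_ceil _).trans (by exact_mod_cast hnt)
  have ht := abs_le.1 hnt'
  refine hpv (φ n) (φ n + 1 + t) ⟨by linarith, by linarith⟩ ?_
  have := (add_latticeVec_mem_openWalls (m (φ n))).2 hn
  convert this using 1
  rw [hq]
  push_cast
  ring

namespace Phase

/-! ### Flights between collisions -/

/-- A straight flight of duration `t` from the collision `x` to the collision `y` (in the copy of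
the scatterer translated by `m`), which may touch scatterers tangentially on the way. These are the
limits of flights between consecutive collisions. -/
def IsFlight (x : B.Phase) (t : ℝ) (m : ℤ × ℤ) (y : B.Phase) : Prop :=
  0 < t ∧ x.pos + t * x.vel = y.pos + latticeVec m ∧
    (∀ s ∈ Ioo 0 t, x.pos + s * x.vel ∉ B.openWalls) ∧
    y.vel = x.vel - 2 * (inner ℝ x.vel y.normal : ℝ) * y.normal

/-- A flight of duration `t` between consecutive collisions. -/
def IsDirectFlight (x : B.Phase) (t : ℝ) (m : ℤ × ℤ) (y : B.Phase) : Prop :=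
  0 < t ∧ x.pos + t * x.vel = y.pos + latticeVec m ∧
    (∀ s ∈ Ioo 0 t, x.pos + s * x.vel ∉ B.walls) ∧
    y.vel = x.vel - 2 * (inner ℝ x.vel y.normal : ℝ) * y.normal

theorem IsDirectFlight.isFlight {x y : B.Phase} {t : ℝ} {m : ℤ × ℤ}
    (h : x.IsDirectFlight t m y) : x.IsFlight t m y :=
  ⟨h.1, h.2.1, fun s hs hw => h.2.2.1 s hs (openWalls_subset_walls hw), h.2.2.2⟩

theorem add_mul_vel_notMem_obstacle (x : B.Phase) {s : ℝ} (hs : 0 < s) :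
    x.pos + s * x.vel ∉ B.obstacle x.1 := by
  intro hmem
  have hne : x.pos + s * x.vel ≠ x.pos := by
    intro h
    have h0 : (s : ℂ) * x.vel = 0 := by simpa using h
    have := congrArg norm h0
    rw [norm_mul, norm_vel, Complex.norm_real, Real.norm_of_nonneg hs.le] at this
    simp at this
    linarith
  have h := x.inner_normal_sub_pos_neg hmem hne
  rw [add_sub_cancel_left, ← Complex.real_smul, real_inner_smul_right, inner_normal_vel] at h
  nlinarith [x.cos_angle_nonneg]

theorem gap_le_of_mem_walls {x : B.Phase} {t : ℝ} (ht : 0 < t)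
    (h : x.pos + t * x.vel ∈ B.walls) : B.gap ≤ t := by
  obtain ⟨j, n, hj⟩ := mem_walls_iff.1 h
  have hne : (x.1, (0 : ℤ × ℤ)) ≠ (j, n) := by
    intro heq
    obtain ⟨rfl, rfl⟩ := Prod.mk.inj heq
    exact x.add_mul_vel_notMem_obstacle ht (by simpa using hj)
  have := gap_le_dist (z := x.pos) hne (by simpa using x.pos_mem_obstacle) hj
  rwa [dist_eq_norm, sub_add_cancel_left, norm_neg, norm_mul, norm_vel, Complex.norm_real,
    Real.norm_of_nonneg ht.le, mul_one] at this

theorem pos_add_latticeVec_mem_walls (y : B.Phase) (m : ℤ × ℤ) :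
    y.pos + latticeVec m ∈ B.walls :=
  mem_walls_iff.2 ⟨y.1, m, by simpa using y.pos_mem_obstacle⟩

theorem IsFlight.gap_le {x y : B.Phase} {t : ℝ} {m : ℤ × ℤ} (h : x.IsFlight t m y) :
    B.gap ≤ t :=
  gap_le_of_mem_walls h.1 (by rw [h.2.1]; exact y.pos_add_latticeVec_mem_walls m)

theorem IsFlight.inner_vel_normal {x y : B.Phase} {t : ℝ} {m : ℤ × ℤ}
    (h : x.IsFlight t m y) : inner ℝ x.vel y.normal = -Real.cos y.angle := by
  have h1 := y.inner_normal_vel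
  rw [h.2.2.2, mul_assoc, inner_sub_right] at h1
  have h2 : (2 : ℂ) * ((inner ℝ x.vel y.normal : ℝ) * y.normal)
      = (2 * (inner ℝ x.vel y.normal : ℝ)) • y.normal := by
    rw [Complex.real_smul]
    push_cast
    ring
  rw [h2, real_inner_smul_right, real_inner_self_eq_norm_sq, norm_normal,
    real_inner_comm] at h1
  linarith

/-- Reflection law: the normal component of the velocity changes sign. -/
theorem IsFlight.vel_eq_add {x y : B.Phase} {t : ℝ} {m : ℤ × ℤ} (h : x.IsFlight t m y) :
    y.vel = x.vel + (2 * Real.cos y.angle) • y.normal := by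
  have := h.2.2.2
  rw [h.inner_vel_normal] at this
  rw [this, Complex.real_smul]
  push_cast
  ring

/-- Tangential collisions do not change the velocity. -/
theorem IsFlight.vel_eq_of_tangential {x y : B.Phase} {t : ℝ} {m : ℤ × ℤ}
    (h : x.IsFlight t m y) (hy : y ∈ B.tangential) : y.vel = x.vel := by
  rw [h.vel_eq_add, mem_tangential_iff.1 hy]
  simp

/-- A flight that goes on straight behind a collision has touched the scatterer tangentially. -/
theorem IsFlight.tangential_of_continues {x y : B.Phase} {t t' : ℝ} {m : ℤ × ℤ}
    (h : x.IsFlight t m y) (htt' : t < t')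
    (h' : ∀ s ∈ Ioo 0 t', x.pos + s * x.vel ∉ B.openWalls) : y ∈ B.tangential := by
  rw [mem_tangential_iff]
  by_contra hne
  have hneg : inner ℝ y.normal x.vel < 0 := by
    rw [real_inner_comm, h.inner_vel_normal]
    have := lt_of_le_of_ne y.cos_angle_nonneg (Ne.symm hne)
    linarith
  obtain ⟨s, hs, hmem⟩ := y.exists_mem_interior hneg (sub_pos.2 htt')
  refine h' (t + s) ⟨by linarith [h.1, hs.1], by linarith [hs.2]⟩ ⟨y.1, m, ?_⟩
  convert hmem using 1
  push_cast
  linear_combination h.2.1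

theorem IsDirectFlight.time_le {x y : B.Phase} {t t' : ℝ} {m : ℤ × ℤ}
    (h : x.IsDirectFlight t m y) (ht' : 0 < t') (hw : x.pos + t' * x.vel ∈ B.walls) : t ≤ t' := by
  by_contra! hlt
  exact h.2.2.1 t' ⟨ht', hlt⟩ hw

theorem IsFlight.eq_of_time_eq {x y y' : B.Phase} {t : ℝ} {m m' : ℤ × ℤ}
    (h : x.IsFlight t m y) (h' : x.IsFlight t m' y') : m = m' ∧ y = y' := by
  have hpos : y.pos + latticeVec m = y'.pos + latticeVec m' := by rw [← h.2.1, ← h'.2.1]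
  refine ⟨(eq_mk_of_pos_eq hpos).1, ext_of_pos_vel hpos ?_⟩
  rw [h.2.2.2, h'.2.2.2, normal_eq_of_pos_eq hpos]

theorem IsDirectFlight.unique {x y y' : B.Phase} {t t' : ℝ} {m m' : ℤ × ℤ}
    (h : x.IsDirectFlight t m y) (h' : x.IsDirectFlight t' m' y') : t = t' ∧ m = m' ∧ y = y' := by
  obtain rfl : t = t' := le_antisymm
    (h.time_le h'.1 (by rw [h'.2.1]; exact y'.pos_add_latticeVec_mem_walls m'))
    (h'.time_le h.1 (by rw [h.2.1]; exact y.pos_add_latticeVec_mem_walls m))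
  exact ⟨rfl, h.isFlight.eq_of_time_eq h'.isFlight⟩

/-- The collision with given place `q` and incoming velocity `v`. The velocity is incoming if the
particle has been outside the scatterer shortly before. -/
theorem exists_reflected {i : Fin B.d} {q v : ℂ} (hq : q ∈ frontier (B.obstacle i))
    (hv : ‖v‖ = 1) {δ : ℝ} (hδ : 0 < δ)
    (hout : ∀ s ∈ Ioo 0 δ, q - s * v ∉ interior (B.obstacle i)) :
    ∃ y : B.Phase, y.1 = i ∧ y.pos = q ∧
      y.vel = v - 2 * (inner ℝ v y.normal : ℝ) * y.normal := by
  rw [← B.range_bdry] at hq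
  obtain ⟨r, rfl⟩ := hq
  set τ := deriv (B.bdry i) r with hτ
  have hτ1 : ‖τ‖ = 1 := B.norm_deriv_bdry i r
  have hdec := eq_inner_smul_add hτ1 v
  set a : ℝ := inner ℝ (Complex.I * τ) v with ha
  set b : ℝ := inner ℝ τ v with hb
  have ha0 : a ≤ 0 := by
    by_contra! hpos
    obtain ⟨s, hs, hmem⟩ := exists_mem_interior_of_inner_neg (i := i) (r := r) (v := -v)
      (by rw [inner_neg_right, ← hτ, ← ha]; linarith) hδ
    refine hout s hs ?_
    convert hmem using 1
    ring
  have hab : a ^ 2 + b ^ 2 = 1 := by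
    have h1 : inner ℝ v v = (1 : ℝ) := by rw [real_inner_self_eq_norm_sq, hv]; norm_num
    nth_rw 1 [hdec] at h1
    rw [← Complex.real_smul, ← Complex.real_smul, inner_add_left, real_inner_smul_left,
      real_inner_smul_left, ← ha, ← hb] at h1
    linarith
  have hb1 : -1 ≤ b ∧ b ≤ 1 := by constructor <;> nlinarith [sq_nonneg a]
  let y : B.Phase := ⟨i, (r : AddCircle (B.perimeter i)), ⟨Real.arcsin b, Real.arcsin_mem_Icc b⟩⟩
  have hyt : y.tangent = τ := tangent_eq (x := y) rfl
  have hyn : y.normal = Complex.I * τ := by rw [normal, hyt]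
  have hcos : Real.cos y.angle = -a := by
    change Real.cos (Real.arcsin b) = -a
    rw [Real.cos_arcsin, show 1 - b ^ 2 = (-a) ^ 2 by linarith,
      Real.sqrt_sq (by linarith)]
  have hsin : Real.sin y.angle = b := Real.sin_arcsin hb1.1 hb1.2
  refine ⟨y, rfl, pos_eq (x := y) rfl, ?_⟩
  rw [vel, hcos, hsin, hyn, hyt, real_inner_comm, ← ha]
  push_cast
  linear_combination -hdec

theorem exists_isDirectFlight (hB : B.FiniteHorizon) (x : B.Phase) :
    ∃ t m y, x.IsDirectFlight t m y := by
  obtain ⟨L, hL⟩ := hB.exists_length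
  obtain ⟨t₁, ht₁, hw₁⟩ := hL x.pos x.vel x.norm_vel
  set S : Set ℝ := Icc B.gap t₁ ∩ {s : ℝ | x.pos + s * x.vel ∈ B.walls} with hS
  have hScpt : IsCompact S := isCompact_Icc.inter_right
    (isClosed_walls.preimage (by fun_prop))
  have hSne : S.Nonempty := ⟨t₁, ⟨gap_le_of_mem_walls ht₁.1 (openWalls_subset_walls hw₁), le_rfl⟩,
    openWalls_subset_walls hw₁⟩
  obtain ⟨t, ⟨⟨htg, htt₁⟩, htw⟩, htmin⟩ := hScpt.exists_isLeast hSne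
  have ht0 : 0 < t := gap_pos.trans_le htg
  have hfirst : ∀ s ∈ Ioo 0 t, x.pos + s * x.vel ∉ B.walls := by
    intro s hs hw
    have := htmin ⟨⟨gap_le_of_mem_walls hs.1 hw, hs.2.le.trans htt₁⟩, hw⟩
    exact absurd hs.2 (not_lt.2 this)
  obtain ⟨i, m, hi⟩ := mem_walls_iff.1 htw
  have hback : ∀ s ∈ Ioo 0 t,
      (x.pos + t * x.vel - latticeVec m) - s * x.vel ∉ B.obstacle i := by
    intro s hs hmem
    refine hfirst (t - s) ⟨by linarith [hs.2], by linarith [hs.1]⟩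
      (mem_walls_iff.2 ⟨i, m, ?_⟩)
    convert hmem using 1
    push_cast
    ring
  have hfr : x.pos + t * x.vel - latticeVec m ∈ frontier (B.obstacle i) := by
    refine ⟨subset_closure hi, fun hint => ?_⟩
    have hcont : Tendsto (fun s : ℝ => (x.pos + t * x.vel - latticeVec m) - s * x.vel) (𝓝[>] 0)
        (𝓝 (x.pos + t * x.vel - latticeVec m)) := by
      have : Continuous (fun s : ℝ => (x.pos + t * x.vel - latticeVec m) - s * x.vel) := by
        fun_prop
      have h2 := this.tendsto 0
      simp only [Complex.ofReal_zero, zero_mul, sub_zero] at h2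
      exact h2.mono_left nhdsWithin_le_nhds
    obtain ⟨s, hs, hs0⟩ := ((hcont.eventually (mem_interior_iff_mem_nhds.1 hint)).and
      (Ioo_mem_nhdsGT ht0)).exists
    exact hback s hs0 hs
  obtain ⟨y, -, hypos, hyvel⟩ := exists_reflected hfr x.norm_vel ht0
    fun s hs hint => hback s hs (interior_subset hint)
  exact ⟨t, m, y, ht0, by rw [hypos]; ring, hfirst, hyvel⟩

open Classical in
/-- The duration of the flight to the next collision. -/
noncomputable def flightTime (x : B.Phase) : ℝ :=
  if h : ∃ t m y, x.IsDirectFlight t m y then h.choose else 0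

theorem exists_isDirectFlight_billiardMap (hB : B.FiniteHorizon) (x : B.Phase) :
    ∃ m, x.IsDirectFlight x.flightTime m (billiardMap x) := by
  have h := exists_isDirectFlight hB x
  have hft : x.flightTime = h.choose := by rw [flightTime, dif_pos h]
  obtain ⟨m, y, hy⟩ := h.choose_spec
  rw [← hft] at hy
  have h2 : ∃ y, x.IsNextCollision y := ⟨y, _, m, hy⟩
  have hbm : billiardMap x = h2.choose := by rw [billiardMap, dif_pos h2]
  obtain ⟨t', m', hy'⟩ := h2.choose_spec
  have hy'' : x.IsDirectFlight t' m' h2.choose := hy'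
  obtain ⟨h3, h4, h5⟩ := hy''.unique hy
  rw [hbm, h5]
  exact ⟨m, hy⟩

theorem IsDirectFlight.eq_billiardMap (hB : B.FiniteHorizon) {x y : B.Phase} {t : ℝ}
    {m : ℤ × ℤ} (h : x.IsDirectFlight t m y) : t = x.flightTime ∧ y = billiardMap x := by
  obtain ⟨m', h'⟩ := exists_isDirectFlight_billiardMap hB x
  obtain ⟨h1, -, h2⟩ := h.unique h'
  exact ⟨h1, h2⟩

theorem gap_le_flightTime (hB : B.FiniteHorizon) (x : B.Phase) : B.gap ≤ x.flightTime := by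
  obtain ⟨m, h⟩ := exists_isDirectFlight_billiardMap hB x
  exact h.isFlight.gap_le

/-- The duration of the flight to the `k`-th collision after `x`. -/
noncomputable def time (k : ℕ) (x : B.Phase) : ℝ :=
  ∑ j ∈ Finset.range k, (billiardMap^[j] x).flightTime

theorem time_one (x : B.Phase) : time 1 x = x.flightTime := by simp [time]

theorem time_succ (k : ℕ) (x : B.Phase) :
    time (k + 1) x = time k x + (billiardMap^[k] x).flightTime :=
  Finset.sum_range_succ _ _

theorem time_add (k l : ℕ) (x : B.Phase) :
    time (k + l) x = time k x + time l (billiardMap^[k] x) := by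
  simp only [time, Finset.sum_range_add, ← Function.iterate_add_apply, Nat.add_comm]

theorem mul_gap_le_time (hB : B.FiniteHorizon) (k : ℕ) (x : B.Phase) : k * B.gap ≤ time k x := by
  have := Finset.card_nsmul_le_sum (Finset.range k)
    (fun j => (billiardMap^[j] x).flightTime) B.gap fun j _ => gap_le_flightTime hB _
  simpa [time] using this

theorem time_add_gap_le (hB : B.FiniteHorizon) {k l : ℕ} (hkl : k < l) (x : B.Phase) :
    time k x + B.gap ≤ time l x := by
  obtain ⟨j, rfl⟩ := Nat.exists_eq_add_of_lt hkl
  rw [add_assoc, time_add]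
  have := mul_gap_le_time hB (j + 1) (billiardMap^[k] x)
  have hg := gap_pos (B := B)
  push_cast at this
  nlinarith [mul_nonneg (Nat.cast_nonneg (α := ℝ) j) hg.le]

theorem exists_flightTime_le (hB : B.FiniteHorizon) :
    ∃ L : ℝ, ∀ x : B.Phase, x.flightTime ≤ L := by
  obtain ⟨L, hL⟩ := hB.exists_length
  refine ⟨L, fun x => ?_⟩
  obtain ⟨t, ht, hw⟩ := hL x.pos x.vel x.norm_vel
  obtain ⟨m, h⟩ := exists_isDirectFlight_billiardMap hB x
  exact (h.time_le ht.1 (openWalls_subset_walls hw)).trans ht.2.le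

end Phase

end DispersingTable

namespace DispersingTable

open Filter Topology

variable {B : DispersingTable}

namespace Phase

/-! ### Chains of flights through tangential collisions -/

theorem IsFlight.trans {x y z : B.Phase} {t t' : ℝ} {m m' : ℤ × ℤ} (h : x.IsFlight t m y)
    (hy : y ∈ B.tangential) (h' : y.IsFlight t' m' z) : x.IsFlight (t + t') (m + m') z := by
  have hv := h.vel_eq_of_tangential hy
  obtain ⟨h1', h2', h3', h4'⟩ := h'
  rw [hv] at h2' h3' h4'
  refine ⟨add_pos h.1 h1', ?_, fun s hs => ?_, h4'⟩
  · rw [latticeVec_add]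
    push_cast
    linear_combination h.2.1 + h2'
  · rcases lt_trichotomy s t with hlt | rfl | hgt
    · exact h.2.2.1 s ⟨hs.1, hlt⟩
    · rw [h.2.1]
      exact notMem_interior_of_frontier (i := y.1) (m := m) (by simpa using y.pos_mem_frontier)
    · have := h3' (s - t) ⟨by linarith, by linarith [hs.2]⟩
      rw [← add_latticeVec_mem_openWalls m] at this
      convert this using 2
      push_cast
      linear_combination h.2.1

/-- A flight is a chain of flights between consecutive collisions, joined by tangential ones. -/
theorem IsFlight.eq_iterate (hB : B.FiniteHorizon) {x z : B.Phase} {t : ℝ} {m : ℤ × ℤ}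
    (h : x.IsFlight t m z) : ∃ a, 0 < a ∧ z = billiardMap^[a] x ∧ t = time a x ∧
      ∀ b, 0 < b → b < a → billiardMap^[b] x ∈ B.tangential := by
  have hg := gap_pos (B := B)
  obtain ⟨n, hn⟩ := exists_nat_gt (t / B.gap)
  rw [div_lt_iff₀ hg] at hn
  induction n generalizing x t m with
  | zero =>
    have := h.1
    simp at hn
    linarith
  | succ n ih =>
    obtain ⟨m', h'⟩ := exists_isDirectFlight_billiardMap hB x
    have hle := h'.time_le h.1 (by rw [h.2.1]; exact z.pos_add_latticeVec_mem_walls m)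
    rcases hle.eq_or_lt with heq | hlt
    · rw [heq] at h'
      obtain ⟨-, hz⟩ := h'.isFlight.eq_of_time_eq h
      exact ⟨1, one_pos, hz.symm, by rw [time_one, heq], fun b hb hb' => by omega⟩
    · have htan := h'.isFlight.tangential_of_continues hlt h.2.2.1
      have hv := h'.isFlight.vel_eq_of_tangential htan
      have hrest : (billiardMap x).IsFlight (t - x.flightTime) (m - m') z := by
        refine ⟨by linarith, ?_, fun s hs => ?_, ?_⟩
        · rw [hv, latticeVec_sub]
          push_cast
          linear_combination h.2.1 - h'.2.1
        · rw [hv, ← add_latticeVec_mem_openWalls m']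
          have := h.2.2.1 (x.flightTime + s) ⟨by linarith [h'.1, hs.1], by linarith [hs.2]⟩
          convert this using 2
          push_cast
          linear_combination -h'.2.1
        · rw [hv]
          exact h.2.2.2
      have hgap := h'.isFlight.gap_le
      obtain ⟨a, ha, hz, ht, hb⟩ := ih hrest (by push_cast at hn; linarith)
      refine ⟨a + 1, by omega, hz, ?_, fun b hb0 hba => ?_⟩
      · rw [add_comm a 1, time_add, time_one, Function.iterate_one, ← ht]
        ring
      · obtain ⟨b, rfl⟩ := Nat.exists_eq_succ_of_ne_zero hb0.ne'
        rcases Nat.eq_zero_or_pos b with rfl | hbpos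
        · exact htan
        · exact hb b hbpos (by omega)

/-- An orbit does not consist of tangential collisions only. -/
theorem exists_iterate_notMem_tangential (hB : B.FiniteHorizon) (x : B.Phase) :
    ∃ k, billiardMap^[k] x ∉ B.tangential := by
  by_contra! hcon
  have hfl : ∀ k, ∃ m, x.IsFlight (time (k + 1) x) m (billiardMap^[k + 1] x) := by
    intro k
    induction k with
    | zero =>
      obtain ⟨m, h⟩ := exists_isDirectFlight_billiardMap hB x
      exact ⟨m, by simpa [time_one] using h.isFlight⟩
    | succ k ih =>
      obtain ⟨m, h⟩ := ih
      obtain ⟨m', h'⟩ := exists_isDirectFlight_billiardMap hB (billiardMap^[k + 1] x)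
      refine ⟨m + m', ?_⟩
      rw [time_succ, Function.iterate_succ_apply' billiardMap (k + 1)]
      exact h.trans (hcon _) h'.isFlight
  obtain ⟨L, hL⟩ := hB.exists_length
  obtain ⟨t, ht, hw⟩ := hL x.pos x.vel x.norm_vel
  obtain ⟨n, hn⟩ := exists_nat_gt (L / B.gap)
  rw [div_lt_iff₀ gap_pos] at hn
  obtain ⟨m, h⟩ := hfl n
  refine h.2.2.1 t ⟨ht.1, ?_⟩ hw
  have h1 := mul_gap_le_time hB (n + 1) x
  have := gap_pos (B := B)
  push_cast at h1
  linarith [ht.2]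

/-! ### Time reversal -/

/-- The collision with reversed velocities. -/
noncomputable def rev (x : B.Phase) : B.Phase :=
  ⟨x.1, x.2.1, ⟨-x.2.2, neg_le_neg x.2.2.2.2, by linarith [x.2.2.2.1]⟩⟩

@[simp] theorem rev_rev (x : B.Phase) : x.rev.rev = x := by
  obtain ⟨i, a, φ, hφ⟩ := x
  simp [rev]

theorem angle_rev (x : B.Phase) : x.rev.angle = -x.angle := rfl

theorem pos_rev (x : B.Phase) : x.rev.pos = x.pos := rfl

theorem normal_rev (x : B.Phase) : x.rev.normal = x.normal := rfl

theorem tangent_rev (x : B.Phase) : x.rev.tangent = x.tangent := rfl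

@[simp] theorem rev_mem_tangential {x : B.Phase} : x.rev ∈ B.tangential ↔ x ∈ B.tangential := by
  rw [mem_tangential_iff, mem_tangential_iff, angle_rev, Real.cos_neg]

theorem continuous_rev : Continuous (rev : B.Phase → B.Phase) := by
  refine continuous_sigma fun i => ?_
  have : Continuous fun p : AddCircle (B.perimeter i) × Icc (-(Real.pi / 2)) (Real.pi / 2) =>
      (p.1, (⟨-p.2, neg_le_neg p.2.2.2, by linarith [p.2.2.1]⟩ :
        Icc (-(Real.pi / 2)) (Real.pi / 2))) := by fun_prop
  exact continuous_sigmaMk.comp this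

theorem vel_rev (x : B.Phase) :
    x.rev.vel = -x.vel + (2 * Real.cos x.angle) • x.normal := by
  rw [vel, vel, angle_rev, normal_rev, tangent_rev, Real.cos_neg, Real.sin_neg, Complex.real_smul]
  push_cast
  ring

theorem IsFlight.vel_rev {x y : B.Phase} {t : ℝ} {m : ℤ × ℤ} (h : x.IsFlight t m y) :
    y.rev.vel = -x.vel := by
  rw [Phase.vel_rev, h.vel_eq_add]
  abel

theorem IsDirectFlight.rev {x y : B.Phase} {t : ℝ} {m : ℤ × ℤ} (h : x.IsDirectFlight t m y) :
    y.rev.IsDirectFlight t (-m) x.rev := by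
  have hv := h.isFlight.vel_rev
  refine ⟨h.1, ?_, fun s hs => ?_, ?_⟩
  · rw [hv, pos_rev, pos_rev, latticeVec_neg]
    linear_combination -h.2.1
  · rw [hv, pos_rev, ← add_latticeVec_mem_walls m]
    have := h.2.2.1 (t - s) ⟨by linarith [hs.2], by linarith [hs.1]⟩
    convert this using 2
    push_cast
    linear_combination -h.2.1
  · rw [hv, normal_rev, Phase.vel_rev, inner_neg_left, real_inner_comm, inner_normal_vel,
      Complex.real_smul]
    push_cast
    ring

theorem billiardMap_rev (hB : B.FiniteHorizon) (x : B.Phase) :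
    x.flightTime = (billiardMap x).rev.flightTime ∧
      x.rev = billiardMap (billiardMap x).rev := by
  obtain ⟨m, h⟩ := exists_isDirectFlight_billiardMap hB x
  exact h.rev.eq_billiardMap hB

theorem iterate_rev_iterate (hB : B.FiniteHorizon) (k : ℕ) (x : B.Phase) :
    billiardMap^[k] (billiardMap^[k] x).rev = x.rev ∧
      time k (billiardMap^[k] x).rev = time k x := by
  induction k with
  | zero => exact ⟨rfl, rfl⟩
  | succ k ih =>
    obtain ⟨h1, h2⟩ := billiardMap_rev hB (billiardMap^[k] x)
    rw [Function.iterate_succ_apply' billiardMap k x]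
    constructor
    · rw [Function.iterate_succ_apply, ← h2, ih.1]
    · rw [time_succ k x, add_comm k 1, time_add, time_one, Function.iterate_one, ← h1, ← h2, ih.2]
      ring

theorem injective_billiardMap (hB : B.FiniteHorizon) :
    Function.Injective (billiardMap : B.Phase → B.Phase) := by
  intro x y hxy
  have h1 := (billiardMap_rev hB x).2
  rw [hxy, ← (billiardMap_rev hB y).2] at h1
  rw [← rev_rev x, h1, rev_rev]

/-! ### Limits of trajectories -/

/-- The limit of a flight between consecutive collisions passes through tangential collisions
only. -/
theorem exists_tendsto_billiardMap (hB : B.FiniteHorizon) {𝓤 : Ultrafilter B.Phase} {x : B.Phase}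
    (hx : ↑𝓤 ≤ 𝓝 x) : ∃ a, 0 < a ∧ (∀ b, 0 < b → b < a → billiardMap^[b] x ∈ B.tangential) ∧
      Tendsto billiardMap 𝓤 (𝓝 (billiardMap^[a] x)) ∧ Tendsto (flightTime (B := B)) 𝓤 (𝓝 (time a x)) ∧
      ∃ m, x.IsFlight (time a x) m (billiardMap^[a] x) ∧
        ∀ᶠ y in (𝓤 : Filter B.Phase), y.IsFlight y.flightTime m (billiardMap y) := by
  choose m hm using fun x : B.Phase => exists_isDirectFlight_billiardMap hB x
  obtain ⟨L, hL⟩ := exists_flightTime_le hB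
  set z := (𝓤.map billiardMap).lim with hz
  have hTz : Tendsto billiardMap 𝓤 (𝓝 z) := (𝓤.map billiardMap).le_nhds_lim
  obtain ⟨t, ⟨ht, -⟩, htlim⟩ := (isCompact_Icc (a := B.gap) (b := L)).ultrafilter_le_nhds'
    (𝓤.map flightTime)
    (Ultrafilter.mem_map.2 (univ_mem' fun y => ⟨gap_le_flightTime hB y, hL y⟩))
  have hft : Tendsto (flightTime (B := B)) 𝓤 (𝓝 t) := htlim
  have ht0 : 0 < t := gap_pos.trans_le ht
  have hposx : Tendsto pos 𝓤 (𝓝 x.pos) := (continuous_pos.tendsto x).mono_left hx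
  have hvelx : Tendsto vel 𝓤 (𝓝 x.vel) := (continuous_vel.tendsto x).mono_left hx
  have hposz := (continuous_pos.tendsto z).comp hTz
  have hvelz := (continuous_vel.tendsto z).comp hTz
  have hnorz := (continuous_normal.tendsto z).comp hTz
  have hftC : Tendsto (fun y : B.Phase => (y.flightTime : ℂ)) 𝓤 (𝓝 (t : ℂ)) :=
    (Complex.continuous_ofReal.tendsto t).comp hft
  have hlv : Tendsto (fun y => latticeVec (m y)) 𝓤 (𝓝 (x.pos + t * x.vel - z.pos)) := by
    refine ((hposx.add (hftC.mul hvelx)).sub hposz).congr fun y => ?_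
    have := (hm y).2.1
    simp only [Function.comp_apply]
    linear_combination this
  obtain ⟨m₀, -, hm₀⟩ := (isClosed_image_latticeVec univ).mem_of_tendsto hlv
    (Eventually.of_forall fun y => mem_image_of_mem _ (mem_univ _))
  rw [← hm₀] at hlv
  have hmconst : ∀ᶠ y in (𝓤 : Filter B.Phase), m y = m₀ := by
    filter_upwards [hlv.eventually (Metric.ball_mem_nhds _ one_pos)] with y hy
    by_contra hne
    have := one_le_norm_latticeVec (sub_ne_zero.2 hne)
    rw [latticeVec_sub, ← dist_eq_norm] at this
    exact absurd hy (not_lt.2 this)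
  have hfl : x.IsFlight t m₀ z := by
    refine ⟨ht0, by rw [hm₀]; ring, fun s hs hw => ?_, ?_⟩
    · have hlim : Tendsto (fun y : B.Phase => y.pos + s * y.vel) 𝓤 (𝓝 (x.pos + s * x.vel)) :=
        hposx.add (hvelx.const_mul _)
      obtain ⟨y, hy, hys⟩ := ((hlim.eventually (isOpen_openWalls.mem_nhds hw)).and
        (hft.eventually (lt_mem_nhds hs.2))).exists
      exact (hm y).isFlight.2.2.1 s ⟨hs.1, hys⟩ hy
    · refine tendsto_nhds_unique hvelz (Tendsto.congr (fun y => ((hm y).2.2.2).symm) ?_)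
      have hin : Tendsto (fun y : B.Phase => inner ℝ y.vel (billiardMap y).normal) 𝓤
          (𝓝 (inner ℝ x.vel z.normal : ℝ)) := hvelx.inner hnorz
      exact hvelx.sub ((((Complex.continuous_ofReal.tendsto _).comp hin).const_mul 2).mul hnorz)
  obtain ⟨a, ha, hza, hta, htan⟩ := hfl.eq_iterate hB
  refine ⟨a, ha, htan, hza ▸ hTz, hta ▸ hft, m₀, ?_, ?_⟩
  · rw [← hza, ← hta]
    exact hfl
  · filter_upwards [hmconst] with y hy
    rw [← hy]
    exact (hm y).isFlight

/-- The iterates of the billiard map at nearby points converge to later iterates at `x`: the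
indices that `κ` skips belong to tangential collisions of `x` which the nearby points miss. -/
theorem exists_tendsto_iterate (hB : B.FiniteHorizon) {𝓤 : Ultrafilter B.Phase} {x : B.Phase}
    (hx : ↑𝓤 ≤ 𝓝 x) : ∃ κ : ℕ → ℕ, StrictMono κ ∧ ∀ k,
      Tendsto billiardMap^[k] 𝓤 (𝓝 (billiardMap^[κ k] x)) ∧
      Tendsto (time (B := B) k) 𝓤 (𝓝 (time (κ k) x)) := by
  have hstep : ∀ p : ℕ × ℕ, ∃ q : ℕ, p.2 < q ∧
      (Tendsto billiardMap^[p.1] 𝓤 (𝓝 (billiardMap^[p.2] x)) ∧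
        Tendsto (time (B := B) p.1) 𝓤 (𝓝 (time p.2 x)) →
      Tendsto billiardMap^[p.1 + 1] 𝓤 (𝓝 (billiardMap^[q] x)) ∧
        Tendsto (time (B := B) (p.1 + 1)) 𝓤 (𝓝 (time q x))) := by
    rintro ⟨k, l⟩
    by_cases h : Tendsto billiardMap^[k] 𝓤 (𝓝 (billiardMap^[l] x)) ∧
        Tendsto (time (B := B) k) 𝓤 (𝓝 (time l x))
    · obtain ⟨a, ha, -, h1, h2, -⟩ := exists_tendsto_billiardMap hB
        (𝓤 := 𝓤.map billiardMap^[k]) h.1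
      refine ⟨l + a, by simpa using ha, fun _ => ⟨?_, ?_⟩⟩
      · rw [add_comm l a, Function.iterate_add_apply, Function.iterate_succ']
        exact h1.comp tendsto_map
      · rw [time_add]
        exact (h.2.add (h2.comp tendsto_map)).congr fun y => (time_succ k y).symm
    · exact ⟨l + 1, by simp, fun h' => absurd h' h⟩
  choose f hf1 hf2 using hstep
  let κ : ℕ → ℕ := fun k => Nat.rec 0 (fun k l => f (k, l)) k
  refine ⟨κ, strictMono_nat_of_lt_succ fun k => hf1 (k, κ k), fun k => ?_⟩
  induction k with
  | zero =>
    refine ⟨hx, ?_⟩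
    simp only [κ]
    exact tendsto_const_nhds
  | succ k ih => exact hf2 (k, κ k) ih

/-- A collision that is not tangential is not lost in a limit. -/
theorem exists_tendsto_iterate_of_notMem (hB : B.FiniteHorizon) {j : ℕ}
    {𝓤 : Ultrafilter B.Phase} {x : B.Phase} (hx : ↑𝓤 ≤ 𝓝 x)
    (hj : billiardMap^[j] x ∉ B.tangential) : ∃ k ≤ j,
      Tendsto billiardMap^[k] 𝓤 (𝓝 (billiardMap^[j] x)) ∧
      Tendsto (time (B := B) k) 𝓤 (𝓝 (time j x)) := by
  induction j using Nat.strong_induction_on generalizing 𝓤 x with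
  | _ j ih =>
    rcases Nat.eq_zero_or_pos j with rfl | hpos
    · exact ⟨0, le_rfl, hx, tendsto_const_nhds⟩
    obtain ⟨a, ha, htan, h1, h2, -⟩ := exists_tendsto_billiardMap hB hx
    have haj : a ≤ j := by
      by_contra! hlt
      exact hj (htan j hpos hlt)
    obtain ⟨k, hk, h3, h4⟩ := ih (j - a) (by omega) (𝓤 := 𝓤.map billiardMap)
      (x := billiardMap^[a] x) h1
      (by rwa [← Function.iterate_add_apply, Nat.sub_add_cancel haj])
    rw [← Function.iterate_add_apply, Nat.sub_add_cancel haj] at h3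
    refine ⟨k + 1, by omega, ?_, ?_⟩
    · rw [Function.iterate_succ]
      exact h3.comp tendsto_map
    · have h5 := h2.add (h4.comp tendsto_map)
      rw [← time_add, Nat.add_sub_cancel' haj] at h5
      refine h5.congr fun y => ?_
      rw [add_comm k 1, time_add, time_one]
      rfl

end Phase

end DispersingTable

namespace DispersingTable

open Filter Topology

variable {B : DispersingTable}

/-! ### Two trajectories with the same itinerary -/

/-- Along the boundary the tangent vectors spread orthogonally to the positions, to first order. -/
theorem eventually_abs_inner_sub_le (i : Fin B.d) (r₀ : ℝ) {ε : ℝ} (hε : 0 < ε) :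
    ∀ᶠ r in 𝓝 r₀,
      |inner ℝ (deriv (B.bdry i) r - deriv (B.bdry i) r₀) (B.bdry i r - B.bdry i r₀)|
        ≤ ε * ‖deriv (B.bdry i) r - deriv (B.bdry i) r₀‖ ^ 2 ∧
      (deriv (B.bdry i) r = deriv (B.bdry i) r₀ → r = r₀) := by
  set γ := B.bdry i with hγ
  set τ := deriv γ r₀ with hτ
  set w := deriv (deriv γ) r₀ with hw
  have hτ1 : ‖τ‖ = 1 := B.norm_deriv_bdry i r₀
  have hw0 : 0 < ‖w‖ := by
    rw [norm_pos_iff]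
    intro h0
    have := B.curvature_bdry i r₀
    rw [← hγ, ← hw, h0] at this
    simp at this
  have horth : inner ℝ w τ = 0 := by
    have h1 : HasDerivAt (fun s => (inner ℝ (deriv γ s) (deriv γ s) : ℝ))
        (inner ℝ τ w + inner ℝ w τ) r₀ :=
      (hasDerivAt_deriv_bdry i r₀).inner ℝ (hasDerivAt_deriv_bdry i r₀)
    have h2 : (fun s => (inner ℝ (deriv γ s) (deriv γ s) : ℝ)) = fun _ => 1 := by
      funext s
      rw [real_inner_self_eq_norm_sq, B.norm_deriv_bdry]
      norm_num
    rw [h2] at h1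
    have h3 := h1.unique (hasDerivAt_const r₀ (1 : ℝ))
    rw [real_inner_comm] at h3
    linarith
  obtain ⟨η, ⟨hη1, hη2⟩, hη0⟩ : ∃ η : ℝ, (‖w‖ * η + η + η * η ≤ ε * (‖w‖ - η) ^ 2 ∧ η < ‖w‖) ∧
      0 < η := by
    have hc1 : Continuous fun η : ℝ => ‖w‖ * η + η + η * η := by fun_prop
    have hc2 : Continuous fun η : ℝ => ε * (‖w‖ - η) ^ 2 := by fun_prop
    have h0 : ∀ᶠ η : ℝ in 𝓝 0, ‖w‖ * η + η + η * η < ε * (‖w‖ - η) ^ 2 := by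
      refine hc1.continuousAt.eventually_lt hc2.continuousAt ?_
      simp only [mul_zero, add_zero, sub_zero]
      positivity
    have h1 : ∀ᶠ η : ℝ in 𝓝[>] 0, _ := nhdsWithin_le_nhds (h0.and (gt_mem_nhds hw0))
    obtain ⟨η, h, h'⟩ := (h1.and self_mem_nhdsWithin).exists
    exact ⟨η, ⟨h.1.le, h.2⟩, h'⟩
  have ha := (hasDerivAt_iff_isLittleO.1 (hasDerivAt_deriv_bdry i r₀)).def hη0
  have hb := (hasDerivAt_iff_isLittleO.1 (hasDerivAt_bdry i r₀)).def hη0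
  filter_upwards [ha, hb] with r ha hb
  rw [← hγ, ← hτ, ← hw] at ha
  rw [← hγ, ← hτ] at hb
  set h := r - r₀ with hh
  set a := deriv γ r - τ - h • w with hadef
  set b := γ r - γ r₀ - h • τ with hbdef
  rw [Real.norm_eq_abs] at ha hb
  have hA : deriv γ r - τ = h • w + a := by rw [hadef]; abel
  have hD : γ r - γ r₀ = h • τ + b := by rw [hbdef]; abel
  have hlow : (‖w‖ - η) * |h| ≤ ‖deriv γ r - τ‖ := by
    have h1 : ‖h • w‖ ≤ ‖deriv γ r - τ‖ + ‖a‖ := by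
      have : h • w = (deriv γ r - τ) - a := by rw [hA]; abel
      rw [this]
      exact norm_sub_le _ _
    rw [norm_smul, Real.norm_eq_abs] at h1
    nlinarith
  constructor
  · have hexp : inner ℝ (deriv γ r - τ) (γ r - γ r₀)
        = h * inner ℝ w b + h * inner ℝ a τ + inner ℝ a b := by
      rw [hA, hD, inner_add_left, inner_add_right, inner_add_right, real_inner_smul_left,
        real_inner_smul_left, real_inner_smul_right, real_inner_smul_right, horth]
      ring
    have e1 : |h * inner ℝ w b| ≤ |h| * (‖w‖ * (η * |h|)) := by
      rw [abs_mul]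
      gcongr
      exact (abs_real_inner_le_norm w b).trans (by gcongr)
    have e2 : |h * inner ℝ a τ| ≤ |h| * (η * |h|) := by
      rw [abs_mul]
      gcongr
      exact (abs_real_inner_le_norm a τ).trans (by rw [hτ1, mul_one]; exact ha)
    have e3 : |inner ℝ a b| ≤ (η * |h|) * (η * |h|) :=
      (abs_real_inner_le_norm a b).trans (by gcongr)
    rw [hexp]
    calc |h * inner ℝ w b + h * inner ℝ a τ + inner ℝ a b|
        ≤ |h * inner ℝ w b| + |h * inner ℝ a τ| + |inner ℝ a b| := abs_add_three _ _ _
      _ ≤ (‖w‖ * η + η + η * η) * |h| ^ 2 := by nlinarith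
      _ ≤ ε * (‖w‖ - η) ^ 2 * |h| ^ 2 := by gcongr
      _ = ε * ((‖w‖ - η) * |h|) ^ 2 := by ring
      _ ≤ ε * ‖deriv γ r - τ‖ ^ 2 := by
        have : 0 ≤ (‖w‖ - η) * |h| := mul_nonneg (by linarith) (abs_nonneg _)
        gcongr
  · intro heq
    rw [heq, sub_self, norm_zero] at hlow
    have : |h| ≤ 0 := by
      by_contra! hpos
      nlinarith
    have h0 : h = 0 := abs_eq_zero.1 (le_antisymm this (abs_nonneg _))
    linarith

namespace Phase

/-- The rate at which the trajectories of two collisions move apart: half of the derivative of the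
squared distance of the particles. -/
noncomputable def spread (y x : B.Phase) : ℝ := inner ℝ (y.vel - x.vel) (y.pos - x.pos)

/-- Dispersion: the spread of two trajectories that are reflected in the same convex scatterers
increases, strictly unless their velocities agree. -/
theorem spread_add_le {x x' y y' : B.Phase} {t s : ℝ} {m : ℤ × ℤ} (hx : x.IsFlight t m x')
    (hy : y.IsFlight s m y') (h : y'.1 = x'.1) :
    spread y x + (s + t) / 2 * ‖y.vel - x.vel‖ ^ 2 ≤ spread y' x' := by
  have hpos : y'.pos - x'.pos = (y.pos - x.pos) + (s • y.vel - t • x.vel) := by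
    rw [Complex.real_smul, Complex.real_smul]
    linear_combination hx.2.1 - hy.2.1
  have h1 : inner ℝ (y.vel - x.vel) (s • y.vel - t • x.vel)
      = (s + t) / 2 * ‖y.vel - x.vel‖ ^ 2 := by
    rw [norm_sub_sq_real, norm_vel, norm_vel, inner_sub_left, inner_sub_right, inner_sub_right,
      real_inner_smul_right, real_inner_smul_right, real_inner_smul_right, real_inner_smul_right,
      real_inner_self_eq_norm_sq, real_inner_self_eq_norm_sq, norm_vel, norm_vel,
      real_inner_comm x.vel y.vel]
    ring
  have h2 : inner ℝ y'.normal (x'.pos - y'.pos) ≤ 0 :=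
    y'.inner_normal_sub_pos_nonpos (by rw [h]; exact x'.pos_mem_obstacle)
  have h3 : inner ℝ x'.normal (y'.pos - x'.pos) ≤ 0 :=
    x'.inner_normal_sub_pos_nonpos (by rw [← h]; exact y'.pos_mem_obstacle)
  rw [← neg_sub, inner_neg_right] at h2
  have h4 : spread y' x' = inner ℝ (y.vel - x.vel) (y'.pos - x'.pos)
      + 2 * Real.cos y'.angle * inner ℝ y'.normal (y'.pos - x'.pos)
      - 2 * Real.cos x'.angle * inner ℝ x'.normal (y'.pos - x'.pos) := by
    rw [spread, hx.vel_eq_add, hy.vel_eq_add, add_sub_add_comm, inner_add_left,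
      inner_sub_left (_ • _), real_inner_smul_left, real_inner_smul_left]
    ring
  have h5 : inner ℝ (y.vel - x.vel) (y'.pos - x'.pos)
      = spread y x + (s + t) / 2 * ‖y.vel - x.vel‖ ^ 2 := by
    rw [hpos, inner_add_right, h1, spread]
  have h6 := mul_nonneg y'.cos_angle_nonneg (by linarith : 0 ≤ inner ℝ y'.normal (y'.pos - x'.pos))
  have h7 := mul_nonneg x'.cos_angle_nonneg
    (by linarith : 0 ≤ -inner ℝ x'.normal (y'.pos - x'.pos))
  rw [h4, h5]
  nlinarith

theorem vel_rev_of_tangential {x : B.Phase} (hx : x ∈ B.tangential) : x.rev.vel = -x.vel := by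
  rw [vel_rev, mem_tangential_iff.1 hx]
  simp

theorem eventually_fst_eq (x : B.Phase) : ∀ᶠ y in 𝓝 x, y.1 = x.1 := by
  have hc : Continuous (Sigma.fst : B.Phase → Fin B.d) := continuous_sigma fun _ => continuous_const
  exact (hc.tendsto x).eventually (p := fun i => i = x.1) (mem_nhds_discrete.2 rfl)

/-- The increase of the spread over `s + 1` flights, estimated by the first and the last one. The
last velocities enter as the velocities of the reversed final collisions. -/
theorem eventually_spread_add_le (hB : B.FiniteHorizon) {𝓤 : Ultrafilter B.Phase} {x : B.Phase}
    (hx : ↑𝓤 ≤ 𝓝 x) (s : ℕ) : ∃ a, Tendsto billiardMap^[s + 1] 𝓤 (𝓝 (billiardMap^[a] x)) ∧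
      ∀ᶠ y in (𝓤 : Filter B.Phase), spread y x + B.gap / 2 * ‖y.vel - x.vel‖ ^ 2
        + B.gap / 2 * ‖(billiardMap^[s + 1] y).rev.vel - (billiardMap^[a] x).rev.vel‖ ^ 2
        ≤ spread (billiardMap^[s + 1] y) (billiardMap^[a] x) := by
  induction s with
  | zero =>
    obtain ⟨a, -, -, h1, -, m, h2, h3⟩ := exists_tendsto_billiardMap hB hx
    refine ⟨a, h1, ?_⟩
    filter_upwards [h3, h1.eventually (eventually_fst_eq _)] with y hy hfst
    have h4 := spread_add_le h2 hy hfst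
    have h5 := hy.gap_le
    have h6 := h2.gap_le
    rw [zero_add, Function.iterate_one, hy.vel_rev, h2.vel_rev, neg_sub_neg, norm_sub_rev x.vel]
    nlinarith [sq_nonneg ‖y.vel - x.vel‖]
  | succ s ih =>
    obtain ⟨a, ha, hle⟩ := ih
    obtain ⟨b, -, -, h1, -, m, h2, h3⟩ := exists_tendsto_billiardMap hB
      (𝓤 := 𝓤.map billiardMap^[s + 1]) ha
    rw [← Function.iterate_add_apply] at h1 h2
    have h3' : ∀ᶠ y in (𝓤 : Filter B.Phase), (billiardMap^[s + 1] y).IsFlight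
        (billiardMap^[s + 1] y).flightTime m (billiardMap (billiardMap^[s + 1] y)) := h3
    have h1' : Tendsto billiardMap^[s + 1 + 1] 𝓤 (𝓝 (billiardMap^[b + a] x)) := by
      rw [Function.iterate_succ' billiardMap (s + 1)]
      exact h1.comp tendsto_map
    refine ⟨b + a, h1', ?_⟩
    filter_upwards [hle, h3', h1'.eventually (eventually_fst_eq _)] with y hley hy hfst
    rw [Function.iterate_succ_apply' billiardMap (s + 1)] at hfst ⊢
    have h4 := spread_add_le h2 hy hfst
    have h5 := hy.gap_le
    have h6 := h2.gap_le
    have hg := gap_pos (B := B)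
    rw [hy.vel_rev, h2.vel_rev, neg_sub_neg, norm_sub_rev (billiardMap^[a] x).vel]
    nlinarith [sq_nonneg ‖(billiardMap^[s + 1] y).vel - (billiardMap^[a] x).vel‖,
      sq_nonneg ‖(billiardMap^[s + 1] y).rev.vel - (billiardMap^[a] x).rev.vel‖]

/-- Near a tangential collision, the spread of tangential collisions is negligible. -/
theorem eventually_abs_spread_le {x : B.Phase} (hx : x ∈ B.tangential) {ε : ℝ} (hε : 0 < ε) :
    ∀ᶠ y in 𝓝 x, y ∈ B.tangential →
      |spread y x| ≤ ε * ‖y.vel - x.vel‖ ^ 2 ∧ (y.vel = x.vel → y = x) := by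
  obtain ⟨i, a, φ⟩ := x
  obtain ⟨r₀, rfl⟩ : ∃ r₀ : ℝ, (r₀ : AddCircle (B.perimeter i)) = a :=
    QuotientAddGroup.mk_surjective a
  have hφ : |(φ : ℝ)| = Real.pi / 2 := hx
  rw [Sigma.nhds_mk, eventually_map]
  have h1 := (B.eventually_abs_inner_sub_le i r₀ hε)
  have h2 : ∀ᶠ b : AddCircle (B.perimeter i) in 𝓝 (r₀ : AddCircle (B.perimeter i)),
      ∃ r : ℝ, (r : AddCircle (B.perimeter i)) = b ∧
      |inner ℝ (deriv (B.bdry i) r - deriv (B.bdry i) r₀) (B.bdry i r - B.bdry i r₀)|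
        ≤ ε * ‖deriv (B.bdry i) r - deriv (B.bdry i) r₀‖ ^ 2 ∧
      (deriv (B.bdry i) r = deriv (B.bdry i) r₀ → r = r₀) := by
    have := QuotientAddGroup.nhds_eq (AddSubgroup.zmultiples (B.perimeter i)) r₀
    rw [show 𝓝 (r₀ : AddCircle (B.perimeter i)) = _ from this, eventually_map]
    filter_upwards [h1] with r hr
    exact ⟨r, rfl, hr⟩
  have h3 : ∀ᶠ ψ : Icc (-(Real.pi / 2)) (Real.pi / 2) in 𝓝 φ, |(ψ : ℝ) - φ| < Real.pi := by
    have : ContinuousAt (fun ψ : Icc (-(Real.pi / 2)) (Real.pi / 2) => |(ψ : ℝ) - φ|) φ := by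
      fun_prop
    exact this.eventually (gt_mem_nhds (by simpa using Real.pi_pos))
  filter_upwards [(continuous_fst.tendsto ((r₀ : AddCircle (B.perimeter i)), φ)).eventually h2,
    (continuous_snd.tendsto ((r₀ : AddCircle (B.perimeter i)), φ)).eventually h3]
  rintro ⟨_, ψ⟩ ⟨r, rfl, hr1, hr2⟩ hψφ htan
  have hψ : |(ψ : ℝ)| = Real.pi / 2 := htan
  have heq : ψ = φ := by
    apply Subtype.ext
    have hpi := Real.pi_pos
    change |(ψ : ℝ) - φ| < Real.pi at hψφ
    rcases abs_eq (by positivity) |>.1 hψ with h | h <;>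
      rcases abs_eq (by positivity) |>.1 hφ with h' | h' <;> rw [h, h'] at hψφ ⊢ <;>
      rw [abs_lt] at hψφ <;> linarith [hψφ.1, hψφ.2]
  subst heq
  have hcos : Real.cos ψ = 0 := mem_tangential_iff.1 htan
  have hsin : |Real.sin ψ| = 1 := by
    have := Real.sin_sq_add_cos_sq ψ
    rw [hcos] at this
    rw [← sq_eq_sq₀ (abs_nonneg _) zero_le_one, sq_abs]
    linarith
  have hv : ∀ r : ℝ, vel (B := B) ⟨i, (r : AddCircle (B.perimeter i)), ψ⟩
      = Real.sin ψ • deriv (B.bdry i) r := by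
    intro r
    have : Real.cos (angle (B := B) ⟨i, (r : AddCircle (B.perimeter i)), ψ⟩) = 0 := hcos
    rw [vel_eq, this, zero_smul, zero_add]
    rfl
  rw [spread, hv, hv, ← smul_sub, norm_smul, Real.norm_eq_abs, hsin, one_mul,
    real_inner_smul_left, abs_mul, hsin, one_mul]
  refine ⟨hr1, fun h => ?_⟩
  have hs0 : Real.sin ψ ≠ 0 := by
    intro h0
    rw [h0] at hsin
    simp at hsin
  rw [hr2 (smul_right_injective ℂ hs0 h)]

/-- A trajectory with two tangential collisions is isolated among the trajectories with the same
itinerary that have the same two tangential collisions. -/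
theorem eventually_eq_of_tangential (hB : B.FiniteHorizon) {𝓤 : Ultrafilter B.Phase}
    {x : B.Phase} (hx : ↑𝓤 ≤ 𝓝 x) (s : ℕ)
    (h0 : ∀ᶠ y in (𝓤 : Filter B.Phase), y ∈ B.tangential)
    (h1 : ∀ᶠ y in (𝓤 : Filter B.Phase), billiardMap^[s + 1] y ∈ B.tangential) :
    ∀ᶠ y in (𝓤 : Filter B.Phase), y = x := by
  obtain ⟨a, ha, hle⟩ := eventually_spread_add_le hB hx s
  have hxt : x ∈ B.tangential := isClosed_tangential.mem_of_tendsto hx h0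
  have hat : billiardMap^[a] x ∈ B.tangential := isClosed_tangential.mem_of_tendsto ha h1
  have hg : 0 < B.gap / 4 := by linarith [gap_pos (B := B)]
  filter_upwards [h0, h1, hle, hx (eventually_abs_spread_le hxt hg),
    ha.eventually (eventually_abs_spread_le hat hg)] with y hy0 hy1 hley e1 e2
  obtain ⟨e1, hxy⟩ := e1 hy0
  obtain ⟨e2, -⟩ := e2 hy1
  rw [vel_rev_of_tangential hy1, vel_rev_of_tangential hat, neg_sub_neg,
    norm_sub_rev (billiardMap^[a] x).vel] at hley
  apply hxy
  have h3 := (abs_le.1 e1).1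
  have h4 := (abs_le.1 e2).2
  have h5 : ‖y.vel - x.vel‖ ^ 2 ≤ 0 := by
    by_contra! hpos
    nlinarith [sq_nonneg ‖(billiardMap^[s + 1] y).vel - (billiardMap^[a] x).vel‖]
  have h6 : ‖y.vel - x.vel‖ = 0 := by nlinarith [norm_nonneg (y.vel - x.vel)]
  exact sub_eq_zero.1 (norm_eq_zero.1 h6)

end Phase

end DispersingTable

/-! ### Simple curves through a point -/

section SimpleCurves

open Filter Topology

/-- Removing a point from a simple curve leaves, locally, at most two connected branches. -/
theorem exists_branches_of_injective {X Y : Type*} [TopologicalSpace X] [T2Space X]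
    [TopologicalSpace Y] [CompactSpace Y]
    (hY : ∀ s : Y, ∀ V ∈ 𝓝 s, ∃ C : Bool → Set Y, (∀ b, IsPreconnected (C b)) ∧
      (∀ b, C b ⊆ V \ {s}) ∧ insert s (C true ∪ C false) ∈ 𝓝 s)
    {f : C(Y, X)} (hf : Function.Injective f) (s : Y) {U : Set X} (hU : U ∈ 𝓝 (f s)) :
    ∃ C : Bool → Set X, (∀ b, IsPreconnected (C b)) ∧
      (∀ b, C b ⊆ (range f ∩ U) \ {f s}) ∧
      ∀ᶠ y in 𝓝[≠] f s, y ∈ range f → ∃ b, y ∈ C b := by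
  obtain ⟨C, hC, hCV, hCn⟩ := hY s (f ⁻¹' U) (f.continuous.continuousAt hU)
  refine ⟨fun b => f '' C b, fun b => (hC b).image f f.continuous.continuousOn, ?_, ?_⟩
  · rintro b _ ⟨u, hu, rfl⟩
    exact ⟨⟨mem_range_self u, (hCV b hu).1⟩, fun h => (hCV b hu).2 (hf h)⟩
  · have hemb := (f.continuous.isClosedEmbedding hf).isEmbedding
    have h1 : f '' insert s (C true ∪ C false) ∈ 𝓝[range f] f s := by
      rw [← hemb.map_nhds_eq]
      exact image_mem_map hCn
    rw [mem_nhdsWithin_iff_eventually] at h1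
    filter_upwards [nhdsWithin_le_nhds h1, self_mem_nhdsWithin] with y hy hne hyr
    obtain ⟨u, hu, rfl⟩ := hy hyr
    rcases hu with rfl | hu | hu
    · exact absurd rfl hne
    · exact ⟨true, u, hu, rfl⟩
    · exact ⟨false, u, hu, rfl⟩

theorem exists_branches_unitInterval (s : unitInterval) (V : Set unitInterval) (hV : V ∈ 𝓝 s) :
    ∃ C : Bool → Set unitInterval, (∀ b, IsPreconnected (C b)) ∧
      (∀ b, C b ⊆ V \ {s}) ∧ insert s (C true ∪ C false) ∈ 𝓝 s := by
  obtain ⟨ε, hε, hball⟩ := Metric.mem_nhds_iff.1 hV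
  let D : Bool → Set ℝ := fun b => if b then Ioo s (s + ε) else Ioo (s - ε) s
  have hD : ∀ b, D b ⊆ Ioo (s - ε) (s + ε) \ {(s : ℝ)} := by
    rintro (_ | _) u ⟨h1, h2⟩
    · exact ⟨⟨h1, by linarith⟩, h2.ne⟩
    · exact ⟨⟨by linarith, h2⟩, h1.ne'⟩
  refine ⟨fun b => Subtype.val ⁻¹' D b, fun b => ?_, fun b u hu => ?_, ?_⟩
  · rw [← Topology.IsInducing.subtypeVal.isPreconnected_image, Subtype.image_preimage_coe]
    have : (D b).OrdConnected := by
      rcases b with _ | _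
      · exact ordConnected_Ioo
      · exact ordConnected_Ioo
    exact (ordConnected_Icc.inter this).isPreconnected
  · obtain ⟨h1, h2⟩ := hD b hu
    refine ⟨hball ?_, fun h => h2 (by rw [mem_singleton_iff.1 h]; rfl)⟩
    rw [Metric.mem_ball, Subtype.dist_eq, Real.dist_eq, abs_lt]
    exact ⟨by linarith [h1.1], by linarith [h1.2]⟩
  · refine mem_of_superset (Metric.ball_mem_nhds s hε) fun u hu => ?_
    rw [Metric.mem_ball, Subtype.dist_eq, Real.dist_eq, abs_lt] at hu
    rcases lt_trichotomy u s with h | h | h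
    · exact Or.inr (Or.inr ⟨by linarith [hu.1], h⟩)
    · exact Or.inl h
    · exact Or.inr (Or.inl ⟨h, by linarith [hu.2]⟩)

theorem exists_branches_addCircle (s : AddCircle (1 : ℝ)) (V : Set (AddCircle (1 : ℝ)))
    (hV : V ∈ 𝓝 s) :
    ∃ C : Bool → Set (AddCircle (1 : ℝ)), (∀ b, IsPreconnected (C b)) ∧
      (∀ b, C b ⊆ V \ {s}) ∧ insert s (C true ∪ C false) ∈ 𝓝 s := by
  obtain ⟨r, rfl⟩ : ∃ r : ℝ, (r : AddCircle (1 : ℝ)) = s := QuotientAddGroup.mk_surjective s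
  have hnhds : 𝓝 (r : AddCircle (1 : ℝ)) = map (fun u : ℝ => (u : AddCircle (1 : ℝ))) (𝓝 r) :=
    QuotientAddGroup.nhds_eq (AddSubgroup.zmultiples (1 : ℝ)) r
  rw [hnhds] at hV ⊢
  obtain ⟨ε, hε, hball⟩ := Metric.mem_nhds_iff.1 (mem_map.1 hV)
  set η := min ε 1 with hη
  have hη0 : 0 < η := lt_min hε one_pos
  have hηε : η ≤ ε := min_le_left _ _
  have hη1 : η ≤ 1 := min_le_right _ _
  let D : Bool → Set ℝ := fun b => if b then Ioo r (r + η) else Ioo (r - η) r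
  have hD : ∀ b, ∀ u ∈ D b, |u - r| < η ∧ u ≠ r := by
    rintro (_ | _) u ⟨h1, h2⟩
    · exact ⟨abs_lt.2 ⟨by linarith, by linarith⟩, h2.ne⟩
    · exact ⟨abs_lt.2 ⟨by linarith, by linarith⟩, h1.ne'⟩
  refine ⟨fun b => (fun u : ℝ => (u : AddCircle (1 : ℝ))) '' D b, fun b => ?_, ?_, ?_⟩
  · have : IsPreconnected (D b) := by
      rcases b with _ | _
      · exact isPreconnected_Ioo
      · exact isPreconnected_Ioo
    exact this.image _ (AddCircle.continuous_mk' 1).continuousOn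
  · rintro b _ ⟨u, hu, rfl⟩
    obtain ⟨h1, h2⟩ := hD b u hu
    refine ⟨hball (by rw [Metric.mem_ball, Real.dist_eq]; linarith), fun h => h2 ?_⟩
    have h0 : ((u - r : ℝ) : AddCircle (1 : ℝ)) = 0 := by
      rw [AddCircle.coe_sub, sub_eq_zero]
      exact h
    obtain ⟨n, hn⟩ := (AddCircle.coe_eq_zero_iff (1 : ℝ)).1 h0
    rw [zsmul_one] at hn
    rw [← hn] at h1
    have h3 : |n| < 1 := by exact_mod_cast h1.trans_le hη1
    rw [Int.abs_lt_one_iff.1 h3, Int.cast_zero] at hn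
    linarith
  · refine mem_map.2 (mem_of_superset (Metric.ball_mem_nhds r hη0) fun u hu => ?_)
    rw [Metric.mem_ball, Real.dist_eq, abs_lt] at hu
    rcases lt_trichotomy u r with h | h | h
    · exact Or.inr (Or.inr ⟨u, ⟨by linarith [hu.1], h⟩, rfl⟩)
    · exact Or.inl (by rw [h])
    · exact Or.inr (Or.inl ⟨u, ⟨h, by linarith [hu.2]⟩, rfl⟩)

variable {X : Type*} [TopologicalSpace X] [T2Space X]

theorem IsSimpleCurve.isClosed {γ : Set X} (h : IsSimpleCurve γ) : IsClosed γ := by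
  rcases h with ⟨f, -, rfl⟩ | ⟨f, -, rfl⟩
  · exact (isCompact_range f.continuous).isClosed
  · have : Fact ((0 : ℝ) < 1) := ⟨one_pos⟩
    exact (isCompact_range f.continuous).isClosed

theorem IsSimpleCurve.exists_branches {γ : Set X} (h : IsSimpleCurve γ) {x : X} (hx : x ∈ γ)
    {U : Set X} (hU : U ∈ 𝓝 x) :
    ∃ C : Bool → Set X, (∀ b, IsPreconnected (C b)) ∧ (∀ b, C b ⊆ (γ ∩ U) \ {x}) ∧
      ∀ᶠ y in 𝓝[≠] x, y ∈ γ → ∃ b, y ∈ C b := by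
  rcases h with ⟨f, hf, rfl⟩ | ⟨f, hf, rfl⟩
  · obtain ⟨s, rfl⟩ := hx
    exact exists_branches_of_injective exists_branches_unitInterval hf s hU
  · obtain ⟨s, rfl⟩ := hx
    have : Fact ((0 : ℝ) < 1) := ⟨one_pos⟩
    exact exists_branches_of_injective exists_branches_addCircle hf s hU

open Classical in
/-- If a union of simple curves is covered, near `x`, by finitely many closed sets which meet only
in `x`, then every branch at `x` of one of the curves lies in one of the closed sets. So at most
twice as many of the closed sets can be accumulated as there are curves through `x`. -/
theorem card_le_two_mul_card_filter {ι : Type*} {Γ : Finset (Set X)}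
    (hΓ : ∀ γ ∈ Γ, IsSimpleCurve γ) {x : X} {F J : Finset ι} (hJF : J ⊆ F) {A : ι → Set X}
    (hA : ∀ i ∈ F, IsClosed (A i))
    (hcover : ∀ᶠ y in 𝓝 x, y ∈ ⋃ γ ∈ Γ, γ → ∃ i ∈ F, y ∈ A i)
    (hdisj : ∀ i ∈ F, ∀ j ∈ F, i ≠ j → ∀ᶠ y in 𝓝[≠] x, ¬ (y ∈ A i ∧ y ∈ A j))
    (hacc : ∀ j ∈ J, ∃ᶠ y in 𝓝[≠] x, y ∈ A j ∧ y ∈ ⋃ γ ∈ Γ, γ) :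
    J.card ≤ 2 * (Γ.filter (fun γ => x ∈ γ)).card := by
  have hdisj' : ∀ᶠ y in 𝓝[≠] x, ∀ i ∈ F, ∀ j ∈ F, i ≠ j → ¬ (y ∈ A i ∧ y ∈ A j) := by
    refine (Filter.eventually_all_finset F).2 fun i hi =>
      (Filter.eventually_all_finset F).2 fun j hj => ?_
    by_cases hij : i = j
    · exact Eventually.of_forall fun y h => absurd hij h
    · filter_upwards [hdisj i hi j hj hij] with y hy _ using hy
  rw [eventually_nhdsWithin_iff] at hdisj'
  have hbr : ∀ γ : Set X, ∃ C : Bool → Set X, γ ∈ Γ → x ∈ γ → (∀ b, IsPreconnected (C b)) ∧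
      (∀ b, C b ⊆ (γ ∩ {y | (y ∈ ⋃ γ ∈ Γ, γ → ∃ i ∈ F, y ∈ A i) ∧
        (y ∈ ({x}ᶜ : Set X) → ∀ i ∈ F, ∀ j ∈ F, i ≠ j → ¬ (y ∈ A i ∧ y ∈ A j))}) \ {x}) ∧
      ∀ᶠ y in 𝓝[≠] x, y ∈ γ → ∃ b, y ∈ C b := by
    intro γ
    by_cases h : γ ∈ Γ ∧ x ∈ γ
    · obtain ⟨C, hC⟩ := (hΓ γ h.1).exists_branches h.2 (hcover.and hdisj')
      exact ⟨C, fun _ _ => hC⟩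
    · exact ⟨fun _ => ∅, fun h1 h2 => absurd ⟨h1, h2⟩ h⟩
  choose C hC using hbr
  have hnear : ∀ᶠ y in 𝓝[≠] x, ∀ γ ∈ Γ, y ∈ γ → x ∈ γ ∧ ∃ b, y ∈ C γ b := by
    refine (Filter.eventually_all_finset Γ).2 fun γ hγ => ?_
    by_cases hx : x ∈ γ
    · filter_upwards [(hC γ hγ hx).2.2] with y hy hyγ using ⟨hx, hy hyγ⟩
    · filter_upwards [nhdsWithin_le_nhds ((hΓ γ hγ).isClosed.isOpen_compl.mem_nhds hx)]
        with y hy hyγ using absurd hyγ hy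
  have hchoice : ∀ j : ι, ∃ p : Set X × Bool, j ∈ J →
      (p.1 ∈ Γ ∧ x ∈ p.1) ∧ (C p.1 p.2 ∩ A j).Nonempty := by
    intro j
    by_cases hj : j ∈ J
    · obtain ⟨y, ⟨hyA, hyΓ⟩, hy⟩ := ((hacc j hj).and_eventually hnear).exists
      simp only [mem_iUnion] at hyΓ
      obtain ⟨γ, hγ, hyγ⟩ := hyΓ
      obtain ⟨hx, b, hb⟩ := hy γ hγ hyγ
      exact ⟨(γ, b), fun _ => ⟨⟨hγ, hx⟩, y, hb, hyA⟩⟩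
    · exact ⟨(∅, true), fun h => absurd h hj⟩
  choose p hp using hchoice
  have hcard : J.card ≤ ((Γ.filter (fun γ => x ∈ γ)) ×ˢ (Finset.univ : Finset Bool)).card := by
    refine Finset.card_le_card_of_injOn p (fun j hj => ?_) fun i hi j hj hij => ?_
    · simp only [Finset.coe_product, Finset.coe_filter, Finset.coe_univ, mem_prod, mem_univ,
        and_true]
      exact (hp j hj).1
    · by_contra hne
      obtain ⟨⟨hγ, hx⟩, hCi⟩ := hp i hi
      obtain ⟨-, hCj⟩ := hp j hj
      rw [← hij] at hCj
      obtain ⟨hconn, hsub, -⟩ := hC _ hγ hx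
      have hR : IsClosed (⋃ k ∈ F.erase i, A k) :=
        isClosed_biUnion_finset fun k hk => hA k (Finset.mem_of_mem_erase hk)
      obtain ⟨y, hyC, hyi, hyR⟩ := isPreconnected_closed_iff.1 (hconn (p i).2) (A i) _
        (hA i (hJF hi)) hR (fun y hy => by
          obtain ⟨⟨hyγ, hyU, -⟩, -⟩ := hsub _ hy
          obtain ⟨k, hk, hyk⟩ := hyU (mem_biUnion hγ hyγ)
          by_cases hki : k = i
          · exact Or.inl (hki ▸ hyk)
          · exact Or.inr (mem_biUnion (Finset.mem_erase.2 ⟨hki, hk⟩) hyk)) hCi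
        (hCj.mono fun y hy => ⟨hy.1,
          mem_biUnion (Finset.mem_erase.2 ⟨Ne.symm hne, hJF hj⟩) hy.2⟩)
      simp only [mem_iUnion] at hyR
      obtain ⟨k, hk, hyk⟩ := hyR
      obtain ⟨hki, hkF⟩ := Finset.mem_erase.1 hk
      obtain ⟨⟨-, -, hyD⟩, hyx⟩ := hsub _ hyC
      exact hyD hyx i (hJF hi) k hkF (Ne.symm hki) ⟨hyi, hyk⟩
  rw [Finset.card_product, Finset.card_univ, Fintype.card_bool] at hcard
  omega

end SimpleCurves

namespace DispersingTable

open Filter Topology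

variable {B : DispersingTable}

namespace Phase

/-! ### The branches of the singularity set -/

/-- The collisions whose trajectory is tangential at a flight time close to `t`. Labelling the
branches of the singularity set by flight times rather than by numbers of collisions makes these
sets closed, since a limit of trajectories may contain additional tangential collisions. -/
def tangentAt (t : ℝ) : Set B.Phase :=
  {y | ∃ k, billiardMap^[k] y ∈ B.tangential ∧ |time k y - t| ≤ B.gap / 3}

theorem exists_eventually_of_tangentAt (hB : B.FiniteHorizon) {𝓤 : Ultrafilter B.Phase} {t : ℝ}
    (h : tangentAt t ∈ 𝓤) : ∃ k, ∀ᶠ y in (𝓤 : Filter B.Phase),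
      billiardMap^[k] y ∈ B.tangential ∧ |time k y - t| ≤ B.gap / 3 := by
  obtain ⟨n, hn⟩ := exists_nat_gt ((t + B.gap / 3) / B.gap)
  rw [div_lt_iff₀ gap_pos] at hn
  have h' : ∀ᶠ y in (𝓤 : Filter B.Phase), ∃ k ∈ Iio n,
      billiardMap^[k] y ∈ B.tangential ∧ |time k y - t| ≤ B.gap / 3 := by
    filter_upwards [h] with y ⟨k, hk1, hk2⟩
    refine ⟨k, ?_, hk1, hk2⟩
    have h1 := mul_gap_le_time hB k y
    have h2 := (abs_le.1 hk2).2
    have h3 : (k : ℝ) * B.gap < n * B.gap := by linarith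
    exact_mod_cast lt_of_mul_lt_mul_right h3 gap_pos.le
  obtain ⟨k, -, hk⟩ := (Ultrafilter.eventually_exists_mem_iff (finite_Iio n)).1 h'
  exact ⟨k, hk⟩

theorem isClosed_tangentAt (hB : B.FiniteHorizon) (t : ℝ) :
    IsClosed (tangentAt t : Set B.Phase) := by
  rw [isClosed_iff_ultrafilter]
  intro x 𝓤 hx hmem
  obtain ⟨k, hk⟩ := exists_eventually_of_tangentAt hB hmem
  obtain ⟨κ, -, hκ⟩ := exists_tendsto_iterate hB hx
  exact ⟨κ k, isClosed_tangential.mem_of_tendsto (hκ k).1 (hk.mono fun y hy => hy.1),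
    le_of_tendsto ((hκ k).2.sub_const t).abs (hk.mono fun y hy => hy.2)⟩

/-- Nearby trajectories with two tangential collisions in common with that of `x` are that of
`x`. -/
theorem eventually_eq_of_iterate_tangential (hB : B.FiniteHorizon) {𝓤 : Ultrafilter B.Phase}
    {x : B.Phase} (hx : ↑𝓤 ≤ 𝓝 x) {k l : ℕ} (hkl : k < l)
    (hk : ∀ᶠ y in (𝓤 : Filter B.Phase), billiardMap^[k] y ∈ B.tangential)
    (hl : ∀ᶠ y in (𝓤 : Filter B.Phase), billiardMap^[l] y ∈ B.tangential) :
    ∀ᶠ y in (𝓤 : Filter B.Phase), y = x := by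
  obtain ⟨s, rfl⟩ := Nat.exists_eq_add_of_lt hkl
  obtain ⟨κ, hκ, hlim⟩ := exists_tendsto_iterate hB hx
  have h1 := eventually_eq_of_tangential hB (𝓤 := 𝓤.map billiardMap^[k]) (hlim k).1 s hk (by
    change ∀ᶠ y in (𝓤 : Filter B.Phase), billiardMap^[s + 1] (billiardMap^[k] y) ∈ B.tangential
    filter_upwards [hl] with y hy
    rwa [← Function.iterate_add_apply, show s + 1 + k = k + s + 1 by ring])
  have h2 : ∀ᶠ y in (𝓤 : Filter B.Phase), y = billiardMap^[κ k - k] x := by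
    have h1' : ∀ᶠ y in (𝓤 : Filter B.Phase), billiardMap^[k] y = billiardMap^[κ k] x := h1
    filter_upwards [h1'] with y hy
    apply (injective_billiardMap hB).iterate k
    rw [hy, ← Function.iterate_add_apply, Nat.add_sub_cancel' (hκ.le_apply)]
  have h3 : x = billiardMap^[κ k - k] x :=
    tendsto_nhds_unique (f := id) hx (tendsto_const_nhds.congr' (h2.mono fun y hy => hy.symm))
  rwa [← h3] at h2

/-- Different branches of the singularity set at `x` meet only in `x`. -/
theorem eventually_not_tangentAt (hB : B.FiniteHorizon) (x : B.Phase) {t t' : ℝ}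
    (htt' : B.gap ≤ |t - t'|) :
    ∀ᶠ y in 𝓝[≠] x, ¬ (y ∈ tangentAt t ∧ y ∈ tangentAt t') := by
  rw [Filter.Eventually, mem_iff_ultrafilter]
  intro 𝓤 hle
  have hx : ↑𝓤 ≤ 𝓝 x := hle.trans nhdsWithin_le_nhds
  have hne : ∀ᶠ y in (𝓤 : Filter B.Phase), y ≠ x := hle self_mem_nhdsWithin
  refine Ultrafilter.eventually_not.2 fun hmem => ?_
  obtain ⟨k, hk⟩ := exists_eventually_of_tangentAt hB (hmem.mono fun y hy => hy.1)
  obtain ⟨l, hl⟩ := exists_eventually_of_tangentAt hB (hmem.mono fun y hy => hy.2)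
  have hk1 := hk.mono fun y hy => hy.1
  have hl1 := hl.mono fun y hy => hy.1
  rcases lt_trichotomy k l with hkl | rfl | hkl
  · obtain ⟨y, hy, hy'⟩ := ((eventually_eq_of_iterate_tangential hB hx hkl hk1 hl1).and hne).exists
    exact hy' hy
  · obtain ⟨y, hy, hy'⟩ := (hk.and hl).exists
    have h1 := abs_sub_le t (time k y) t'
    rw [abs_sub_comm] at hy
    have := gap_pos (B := B)
    linarith [hy.2, hy'.2]
  · obtain ⟨y, hy, hy'⟩ := ((eventually_eq_of_iterate_tangential hB hx hkl hl1 hk1).and hne).exists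
    exact hy' hy

theorem mem_singularSet {n : ℕ} {y : B.Phase} :
    y ∈ B.singularSet n ↔ ∃ k ≤ n, billiardMap^[k] y ∈ B.tangential := by
  simp [singularSet]

/-- Near `x`, the singularity set consists of branches which belong to tangential collisions of
`x`. -/
theorem exists_eventually_mem_tangentAt (hB : B.FiniteHorizon) (x : B.Phase) (n : ℕ) :
    ∃ M, ∀ M' ≥ M, ∀ᶠ y in 𝓝 x, y ∈ B.singularSet n →
      ∃ k ≤ M', billiardMap^[k] x ∈ B.tangential ∧ y ∈ tangentAt (time k x) := by
  obtain ⟨L, hL⟩ := exists_flightTime_le (B := B) hB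
  have hL0 : 0 ≤ L := gap_pos.le.trans ((gap_le_flightTime hB x).trans (hL x))
  obtain ⟨M, hM⟩ := exists_nat_gt (n * L / B.gap)
  rw [div_lt_iff₀ gap_pos] at hM
  refine ⟨M, fun M' hM' => ?_⟩
  rw [Filter.Eventually, mem_iff_ultrafilter]
  intro 𝓤 hx
  refine Ultrafilter.eventually_imp.2 fun hmem => ?_
  obtain ⟨κ, -, hκ⟩ := exists_tendsto_iterate hB hx
  have hmem' : ∀ᶠ y in (𝓤 : Filter B.Phase), ∃ k ∈ Iic n, billiardMap^[k] y ∈ B.tangential := by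
    filter_upwards [hmem] with y hy using mem_singularSet.1 hy
  obtain ⟨k, hkn, hk⟩ := (Ultrafilter.eventually_exists_mem_iff (finite_Iic n)).1 hmem'
  have htime : time (κ k) x ≤ n * L := by
    refine le_of_tendsto (hκ k).2 (Eventually.of_forall fun y => ?_)
    have h1 : time k y ≤ k * L := by
      simpa [time] using Finset.sum_le_card_nsmul (Finset.range k)
        (fun j => (billiardMap^[j] y).flightTime) L fun j _ => hL _
    have h2 : (k : ℝ) ≤ n := by exact_mod_cast hkn
    exact h1.trans (by gcongr)
  have hκM : κ k ≤ M' := by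
    have h1 := mul_gap_le_time hB (κ k) x
    have h3 : (κ k : ℝ) * B.gap < M * B.gap := by linarith
    have h4 : κ k < M := by exact_mod_cast lt_of_mul_lt_mul_right h3 gap_pos.le
    omega
  have hg : 0 < B.gap / 3 := by linarith [gap_pos (B := B)]
  filter_upwards [hk, (hκ k).2.eventually (Metric.closedBall_mem_nhds _ hg)] with y hy hy'
  exact ⟨κ k, hκM, isClosed_tangential.mem_of_tendsto (hκ k).1 hk, k, hy, hy'⟩

/-- A tangential collision is not isolated among the tangential ones. -/
theorem neBot_nhdsWithin_tangential {x : B.Phase} (hx : x ∈ B.tangential) :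
    (𝓝[B.tangential \ {x}] x).NeBot := by
  obtain ⟨i, a, φ⟩ := x
  obtain ⟨r, rfl⟩ : ∃ r : ℝ, (r : AddCircle (B.perimeter i)) = a := QuotientAddGroup.mk_surjective a
  have hp := B.perimeter_pos i
  let g : ℝ → B.Phase := fun h => ⟨i, ((r + h : ℝ) : AddCircle (B.perimeter i)), φ⟩
  have hg0 : g 0 = ⟨i, (r : AddCircle (B.perimeter i)), φ⟩ := by simp [g]
  have hcont : Continuous g := by
    refine continuous_sigmaMk.comp ?_
    have : Continuous fun h : ℝ => ((r + h : ℝ) : AddCircle (B.perimeter i)) :=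
      (AddCircle.continuous_mk' _).comp (by fun_prop)
    exact this.prodMk continuous_const
  have hlim : Tendsto g (𝓝[>] 0) (𝓝[B.tangential \ {g 0}] (g 0)) := by
    refine tendsto_nhdsWithin_iff.2 ⟨(hcont.tendsto 0).mono_left nhdsWithin_le_nhds, ?_⟩
    filter_upwards [Ioo_mem_nhdsGT hp] with h hh
    refine ⟨hx, fun heq => ?_⟩
    have h1 : g h = g 0 := heq
    simp only [g, Sigma.mk.injEq, heq_eq_eq, Prod.mk.injEq, true_and, and_true, add_zero] at h1
    rw [AddCircle.coe_add, add_eq_left, ← AddCircle.coe_zero, AddCircle.coe_eq_coe_iff_of_mem_Ico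
      (a := 0) (by rw [zero_add]; exact ⟨hh.1.le, hh.2⟩)
      (by rw [zero_add]; exact ⟨le_rfl, hp⟩)] at h1
    exact hh.1.ne' h1
  rw [hg0] at hlim
  exact hlim.neBot

/-- Every tangential collision of a nontangential `x` contributes a branch of the singularity set
which ends in `x`: the tangential collisions near it, followed backwards in time. -/
theorem frequently_mem_tangentAt (hB : B.FiniteHorizon) {x : B.Phase} (hx : x ∉ B.tangential)
    {j n : ℕ} (hjn : j ≤ n) (hj : billiardMap^[j] x ∈ B.tangential) :
    ∃ᶠ y in 𝓝[≠] x, y ∈ tangentAt (time j x) ∧ y ∈ B.singularSet n := by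
  set z := billiardMap^[j] x with hz
  have := neBot_nhdsWithin_tangential hj
  set 𝓥 := Ultrafilter.of (𝓝[B.tangential \ {z}] z) with h𝓥
  have h𝓥le : ↑𝓥 ≤ 𝓝[B.tangential \ {z}] z := Ultrafilter.of_le _
  have h𝓥z : ↑𝓥 ≤ 𝓝 z := h𝓥le.trans nhdsWithin_le_nhds
  have hmem : ∀ᶠ w in (𝓥 : Filter B.Phase), w ∈ B.tangential \ {z} := h𝓥le self_mem_nhdsWithin
  obtain ⟨h1, h2⟩ := iterate_rev_iterate hB j x
  rw [← hz] at h1 h2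
  obtain ⟨k, hkj, hk1, hk2⟩ := exists_tendsto_iterate_of_notMem hB (𝓤 := 𝓥.map rev) (x := z.rev)
    (j := j) ((continuous_rev.tendsto z).mono_left h𝓥z) (by rwa [h1, rev_mem_tangential])
  rw [h1] at hk1
  rw [h2] at hk2
  let f : B.Phase → B.Phase := fun w => (billiardMap^[k] w.rev).rev
  have hf : Tendsto f 𝓥 (𝓝 x) := by
    have h3 := (continuous_rev.tendsto _).comp (hk1.comp tendsto_map)
    rwa [rev_rev] at h3
  have hfk : ∀ w, billiardMap^[k] (f w) = w := fun w => by
    have := (iterate_rev_iterate hB k w.rev).1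
    rwa [rev_rev] at this
  have hft : ∀ w, time k (f w) = time k w.rev := fun w => (iterate_rev_iterate hB k w.rev).2
  have hne : ∀ᶠ w in (𝓥 : Filter B.Phase), f w ≠ x := by
    refine Ultrafilter.eventually_not.2 fun hcon => ?_
    have hconst : ∀ᶠ w in (𝓥 : Filter B.Phase), billiardMap^[k] x = w := by
      filter_upwards [hcon] with w hw
      rw [← hw, hfk]
    have hzx : z = billiardMap^[k] x :=
      tendsto_nhds_unique (f := id) h𝓥z (tendsto_const_nhds.congr' hconst)
    obtain ⟨w, hw, hw'⟩ := (hconst.and hmem).exists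
    exact hw'.2 (by rw [← hw, ← hzx]; rfl)
  have hg : 0 < B.gap / 3 := by linarith [gap_pos (B := B)]
  have hk3 : Tendsto (fun w : B.Phase => time k w.rev) 𝓥 (𝓝 (time j x)) := hk2.comp tendsto_map
  have hgood : ∀ᶠ w in (𝓥 : Filter B.Phase),
      f w ∈ tangentAt (time j x) ∧ f w ∈ B.singularSet n := by
    filter_upwards [hmem, hk3.eventually (Metric.closedBall_mem_nhds _ hg)] with w hw hw'
    have htan : billiardMap^[k] (f w) ∈ B.tangential := by
      rw [hfk]
      exact hw.1
    exact ⟨⟨k, htan, by rw [hft]; exact hw'⟩, mem_singularSet.2 ⟨k, hkj.trans hjn, htan⟩⟩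
  have hf' : Tendsto f 𝓥 (𝓝[≠] x) := tendsto_nhdsWithin_iff.2 ⟨hf, hne⟩
  exact hf'.frequently hgood.frequently

open Classical in
/-- The complexity bounds the number of tangential collisions of an orbit. -/
theorem card_tangential_le (hB : B.FiniteHorizon) {x : B.Phase} (hx : x ∉ B.tangential)
    {K : ℕ} {n : ℕ} (hK : B.complexity n ≤ K) {J : Finset ℕ}
    (hJ : ∀ j ∈ J, j ≤ n ∧ billiardMap^[j] x ∈ B.tangential) : J.card ≤ 2 * K := by
  have hlt : B.complexity n < (K : ℕ∞) + 1 :=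
    hK.trans_lt (by exact_mod_cast Nat.lt_succ_self K)
  rw [complexity] at hlt
  simp only [iInf_lt_iff] at hlt
  obtain ⟨Γ, ⟨hΓ, hΓS⟩, hlt⟩ := hlt
  have hcard : (Γ.filter (fun γ => x ∈ γ)).card ≤ K := by
    have h1 : (((Γ.filter (fun γ => x ∈ γ)).card : ℕ∞)) < (K : ℕ∞) + 1 :=
      (le_iSup (fun x : B.Phase => ((Γ.filter (fun γ => x ∈ γ)).card : ℕ∞)) x).trans_lt hlt
    have h2 : (Γ.filter (fun γ => x ∈ γ)).card < K + 1 := by exact_mod_cast h1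
    omega
  obtain ⟨M, hM⟩ := exists_eventually_mem_tangentAt hB x n
  set F := (Finset.range (max M n + 1)).filter (fun k => billiardMap^[k] x ∈ B.tangential) with hF
  have hmemF : ∀ k, k ∈ F ↔ k ≤ max M n ∧ billiardMap^[k] x ∈ B.tangential := fun k => by
    rw [hF, Finset.mem_filter, Finset.mem_range, Nat.lt_succ_iff]
  have := card_le_two_mul_card_filter hΓ (x := x) (F := F) (J := J)
    (A := fun k => tangentAt (time k x))
    (fun j hj => (hmemF j).2 ⟨(hJ j hj).1.trans (le_max_right _ _), (hJ j hj).2⟩)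
    (fun _ _ => isClosed_tangentAt hB _)
    (by
      rw [hΓS]
      filter_upwards [hM _ (le_max_left M n)] with y hy hyS
      obtain ⟨k, hk, hkt, hyk⟩ := hy hyS
      exact ⟨k, (hmemF k).2 ⟨hk, hkt⟩, hyk⟩)
    (fun k _ l _ hkl => eventually_not_tangentAt hB x (by
      rcases Nat.lt_or_gt_of_ne hkl with h | h
      · have := time_add_gap_le hB h x
        rw [abs_sub_comm]
        exact (by linarith : B.gap ≤ time l x - time k x).trans (le_abs_self _)
      · have := time_add_gap_le hB h x
        exact (by linarith : B.gap ≤ time k x - time l x).trans (le_abs_self _)))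
    (fun j hj => by
      rw [hΓS]
      exact frequently_mem_tangentAt hB hx (hJ j hj).1 (hJ j hj).2)
  omega

/-- If all complexities are at most `K`, no orbit has more than `2 K` tangential collisions. -/
theorem card_le_of_complexity_le (hB : B.FiniteHorizon) {K : ℕ}
    (hK : ∀ n, B.complexity n ≤ K) (x : B.Phase) {J : Finset ℕ}
    (hJ : ∀ j ∈ J, billiardMap^[j] x ∈ B.tangential) : J.card ≤ 2 * K := by
  -- follow the orbit back to a nontangential collision
  obtain ⟨b, hb⟩ := exists_iterate_notMem_tangential hB x.rev
  have hbx : billiardMap^[b] (billiardMap^[b] x.rev).rev = x := by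
    rw [(iterate_rev_iterate hB b x.rev).1, rev_rev]
  have h := card_tangential_le hB (x := (billiardMap^[b] x.rev).rev)
    (by rwa [rev_mem_tangential]) (hK ((J.image (· + b)).sup id)) (J := J.image (· + b))
    (fun j hj => ⟨Finset.le_sup (f := id) hj, by
      obtain ⟨i, hi, rfl⟩ := Finset.mem_image.1 hj
      rw [Function.iterate_add_apply, hbx]
      exact hJ i hi⟩)
  rwa [Finset.card_image_of_injective _ (add_left_injective b)] at h

/-- Orbit segments with many almost tangential collisions accumulate at orbits with at least as
many tangential ones. -/
theorem exists_card_tangential (hB : B.FiniteHorizon) {m n : ℕ}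
    (h : ∀ φ ∈ Ioo 0 (Real.pi / 2), ∃ x : B.Phase,
      m < ((Finset.range n).filter (fun k => φ < |angle (billiardMap^[k] x)|)).card) :
    ∃ (x : B.Phase) (J : Finset ℕ), m < J.card ∧ ∀ j ∈ J, billiardMap^[j] x ∈ B.tangential := by
  obtain ⟨φ, -, hφ, hlim⟩ := exists_seq_strictMono_tendsto' (half_pos Real.pi_pos)
  choose x hx using fun l => h (φ l) (hφ l)
  set 𝓦 : Ultrafilter ℕ := Ultrafilter.of atTop with h𝓦
  have h𝓦le : ↑𝓦 ≤ (atTop : Filter ℕ) := Ultrafilter.of_le _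
  -- along an ultrafilter, the almost tangential collisions have constant indices
  have hpat : ∀ᶠ l in (𝓦 : Filter ℕ), ∃ P ∈ ((Finset.range n).powerset : Set (Finset ℕ)),
      (Finset.range n).filter (fun k => φ l < |angle (billiardMap^[k] (x l))|) = P :=
    Eventually.of_forall fun l => ⟨_, Finset.mem_powerset.2 (Finset.filter_subset _ _), rfl⟩
  obtain ⟨P, -, hP⟩ := (Ultrafilter.eventually_exists_mem_iff (Finset.finite_toSet _)).1 hpat
  have hx₀ : ↑(𝓦.map x) ≤ 𝓝 (𝓦.map x).lim := Ultrafilter.le_nhds_lim _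
  obtain ⟨κ, hκ, hκlim⟩ := exists_tendsto_iterate hB hx₀
  refine ⟨(𝓦.map x).lim, P.image κ, ?_, fun j hj => ?_⟩
  · rw [Finset.card_image_of_injective _ hκ.injective]
    obtain ⟨l, hl⟩ := hP.exists
    rw [← hl]
    exact hx l
  · obtain ⟨k, hk, rfl⟩ := Finset.mem_image.1 hj
    refine le_antisymm (abs_angle_le _) ?_
    have h1 : Tendsto (fun l => |angle (billiardMap^[k] (x l))|) 𝓦
        (𝓝 |angle (billiardMap^[κ k] (𝓦.map x).lim)|) :=
      ((continuous_angle.tendsto _).comp ((hκlim k).1.comp tendsto_map)).abs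
    refine le_of_tendsto_of_tendsto (hlim.mono_left h𝓦le) h1 ?_
    filter_upwards [hP] with l hl
    rw [← hl, Finset.mem_filter] at hk
    exact hk.2.le

end Phase

end DispersingTable

theorem mainTheorem8 (B : DispersingTable) (hB : B.FiniteHorizon)
    (hK : ∃ K : ℕ, ∀ n : ℕ, B.complexity n ≤ K) (ε₀ : ℝ) (hε₀ : 0 < ε₀) :
    ∃ (n₀ : ℕ) (φ₀ : ℝ), 0 < n₀ ∧ 0 < φ₀ ∧ φ₀ < Real.pi / 2 ∧ B.sparseness φ₀ n₀ < ε₀ := by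
  obtain ⟨K, hK⟩ := hK
  set s : ℝ := min (ε₀ / 2) 1 with hs
  have hs0 : 0 < s := lt_min (by linarith) one_pos
  obtain ⟨n₀, hn₀⟩ := exists_nat_gt (2 * K / s)
  rw [div_lt_iff₀ hs0] at hn₀
  have hn₀pos : 0 < n₀ := by
    rcases Nat.eq_zero_or_pos n₀ with rfl | h
    · have : (0 : ℝ) ≤ K := Nat.cast_nonneg K
      simp at hn₀
      linarith
    · exact h
  by_contra! hcon
  obtain ⟨x, J, hJ, hJt⟩ := DispersingTable.Phase.exists_card_tangential hB (m := 2 * K) (n := n₀) (by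
    intro φ hφ
    by_contra! hle
    have h1 := hcon n₀ φ hn₀pos hφ.1 hφ.2
    have h2 : B.sparseness φ n₀ ≤ s := by
      refine csInf_le ⟨0, fun _ h => h.1.1⟩ ⟨⟨hs0.le, min_le_right _ _⟩, fun x => ?_⟩
      have h3 : (((Finset.range n₀).filter
          (fun k => φ < |DispersingTable.Phase.angle (DispersingTable.billiardMap^[k] x)|)).card : ℝ) ≤ 2 * K := by
        exact_mod_cast hle x
      refine le_trans (le_of_eq ?_) (h3.trans (by linarith))
      congr!
    have h3 : s ≤ ε₀ / 2 := min_le_left _ _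
    linarith)
  exact absurd (DispersingTable.Phase.card_le_of_complexity_le hB hK x hJt) (not_le.2 hJ)
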